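/- Let $L^p(\mathbb R)$ denote the space of complex-valued $p$-integrable functions on $\mathbb R$ (modulo null sets), and let $I$ be the identity operator. The Hilbert transform $H$ on $L^2(\mathbb R)$ is defined by $\widehat{Hf}(\omega) = -i\,\operatorname{sign}(\omega)\,\hat f(\omega)$. \textbf{Proposition.} Let $1 < p < \infty$. Then there is a unique bounded linear operator on $L^p(\mathbb R)$ that agrees with the $L^2$ Hilbert transform on $L^2(\mathbb R)\cap L^p(\mathbb R)$. Denote it again by $H$, and for real $\tau$ put $$H_\tau = \cos(\pi\tau)\, I - \sin(\pi\tau)\, H .$$ Then $H^2 = -I$ on $L^p(\mathbb R)$, and for all real $\tau_1,\tau_2,\tau$ $$H_{\tau_1} H_{\tau_2} = H_{\tau_1+\tau_2},\qquad H_0 = I,\qquad H_\tau H_{-\tau} = H_{-\tau} H_\tau = I .$$ Consequently the set of operators $\{H_\tau : \tau\in\mathbb R\}$ is a commutative group under composition: it is a commutative subgroup of the group of bounded, boundedly invertible linear operators on $L^p(\mathbb R)$, with identity $H_0 = I$ and inverse $H_\tau^{-1} = H_{-\tau}$. -/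

import Mathlib

open MeasureTheory FourierTransform
open scoped ENNReal

noncomputable section

/-- The frequency response `ξ ↦ -i sign ξ` of the Hilbert transform. It is invariant under positive
dilations of `ξ`, hence the same for the kernels `exp (-i x ξ)` and `exp (-2 π i x ξ)`. -/
def hilbertSymbol (ξ : ℝ) : ℂ := -Complex.I * (Real.sign ξ : ℂ)

theorem measurable_hilbertSymbol : Measurable hilbertSymbol := by
  have h : Measurable Real.sign := by
    unfold Real.sign
    exact Measurable.ite measurableSet_Iio measurable_const
      (Measurable.ite measurableSet_Ioi measurable_const measurable_const)
  exact measurable_const.mul (Complex.measurable_ofReal.comp h)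

theorem norm_hilbertSymbol_le (ξ : ℝ) : ‖hilbertSymbol ξ‖ ≤ 1 := by
  rcases Real.sign_apply_eq ξ with h | h | h <;> simp [hilbertSymbol, h]

theorem memLp_top_hilbertSymbol : MemLp hilbertSymbol ∞ (volume : Measure ℝ) :=
  memLp_top_of_bound measurable_hilbertSymbol.aestronglyMeasurable 1
    (Filter.Eventually.of_forall norm_hilbertSymbol_le)

/-- Multiplication by the frequency response `ξ ↦ -i sign ξ` on `L²(ℝ)`. -/
def hilbertMul : Lp ℂ 2 (volume : Measure ℝ) →L[ℂ] Lp ℂ 2 (volume : Measure ℝ) :=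
  (ContinuousLinearMap.mul ℂ ℂ).holderL volume ∞ 2 2 (memLp_top_hilbertSymbol.toLp hilbertSymbol)

/-- The Hilbert transform on `L²(ℝ)`: Fourier transform, multiplication by `-i sign ξ`,
inverse Fourier transform. -/
def hilbertL2 : Lp ℂ 2 (volume : Measure ℝ) →L[ℂ] Lp ℂ 2 (volume : Measure ℝ) :=
  ((Lp.fourierTransformₗᵢ ℝ ℂ).symm.toContinuousLinearEquiv :
      Lp ℂ 2 (volume : Measure ℝ) →L[ℂ] Lp ℂ 2 (volume : Measure ℝ)) ∘L hilbertMul ∘L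
    ((Lp.fourierTransformₗᵢ ℝ ℂ).toContinuousLinearEquiv :
      Lp ℂ 2 (volume : Measure ℝ) →L[ℂ] Lp ℂ 2 (volume : Measure ℝ))

/-- The Fourier transform of `hilbertL2 f` is `-i sign ξ` times that of `f`. -/
theorem fourier_hilbertL2 (f : Lp ℂ 2 (volume : Measure ℝ)) :
    (𝓕 (hilbertL2 f) : Lp ℂ 2 (volume : Measure ℝ)) =ᵐ[volume]
      fun ξ => hilbertSymbol ξ * (𝓕 f : Lp ℂ 2 (volume : Measure ℝ)) ξ := by
  have h1 : (𝓕 (hilbertL2 f) : Lp ℂ 2 (volume : Measure ℝ)) = hilbertMul (𝓕 f) :=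
    (Lp.fourierTransformₗᵢ ℝ ℂ).apply_symm_apply _
  rw [h1]
  have h2 := (ContinuousLinearMap.mul ℂ ℂ).coeFn_holder (r := 2)
    (memLp_top_hilbertSymbol.toLp hilbertSymbol) (𝓕 f : Lp ℂ 2 (volume : Measure ℝ))
  filter_upwards [h2, memLp_top_hilbertSymbol.coeFn_toLp] with ξ h h'
  rw [h'] at h
  exact h

/-- The bounded operator `T` on `Lᵖ(ℝ)` agrees with the `L²` Hilbert transform on
`L²(ℝ) ∩ Lᵖ(ℝ)`. -/
def ExtendsHilbertL2 (p : ℝ≥0∞) [Fact (1 ≤ p)]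
    (T : Lp ℂ p (volume : Measure ℝ) →L[ℂ] Lp ℂ p (volume : Measure ℝ)) : Prop :=
  ∀ (f : ℝ → ℂ) (hf2 : MemLp f 2 volume) (hfp : MemLp f p volume),
    T (hfp.toLp f) =ᵐ[volume] hilbertL2 (hf2.toLp f)

open Classical in
/-- The Hilbert transform on `Lᵖ(ℝ)`: the bounded operator that extends the `L²` Hilbert transform
from `L²(ℝ) ∩ Lᵖ(ℝ)` (and the zero operator should no such extension exist). -/
def hilbertTransform (p : ℝ≥0∞) [Fact (1 ≤ p)] :
    Lp ℂ p (volume : Measure ℝ) →L[ℂ] Lp ℂ p (volume : Measure ℝ) :=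
  if h : ∃ T, ExtendsHilbertL2 p T then h.choose else 0

/-- The fractional Hilbert transform `H_τ = cos (π τ) I - sin (π τ) H` on `Lᵖ(ℝ)`. -/
def fHT (p : ℝ≥0∞) [Fact (1 ≤ p)] (τ : ℝ) :
    Lp ℂ p (volume : Measure ℝ) →L[ℂ] Lp ℂ p (volume : Measure ℝ) :=
  (Real.cos (Real.pi * τ) : ℂ) • ContinuousLinearMap.id ℂ (Lp ℂ p (volume : Measure ℝ)) -
    (Real.sin (Real.pi * τ) : ℂ) • hilbertTransform p

end

/-! All but the boundedness of H on Lᵖ is algebra and density. By Plancherel, H is an isometry of L²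
with H² = -I, since its symbol squares to -1 off the origin. Once ‖Hf‖_p ≤ C‖f‖_p on L² ∩ Lᵖ
(`IsHilbertBounded`), H extends uniquely from this dense H-invariant subspace and H² = -I persists.
Then cos(πτ) I - sin(πτ) H multiplies like cos(πτ) - i sin(πτ), so τ ↦ H_τ is a homomorphism from ℝ,
and its image is the required group.

The bound is M. Riesz's theorem, proved by complex analysis. Let f ≥ 0 be integrable, compactly
supported and not a.e. zero. Its Cauchy integral F is holomorphic on the upper half-plane, and Re F
> 0 is the Poisson integral of f. For 1 < p < 2 the right half-plane satisfies |z|ᵖ ≤ A (Re z)ᵖ - B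
Re zᵖ (`exists_norm_rpow_le_re_rpow_sub`). Put z = F and integrate along a horizontal line: the
B-term vanishes by Cauchy's theorem (`tendsto_integral_cauchyTransform_cpow`), and the A-term is at
most A‖f‖_pᵖ because Poisson averages contract Lᵖ. This bounds F in Lᵖ uniformly in the height y of
the line.

On the Fourier side, restricting F to Im z = y multiplies the transform of f by `cauchySymbol y`
(`cauchyTransform_eq_fourierInv`). As y → 0 this gives f + iHf in L², and Fatou carries the bound
over. Truncation and a splitting into four nonnegative parts treat all f; p = 2 is Plancherel, and p
> 2 follows by duality, H being skew-adjoint. -/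

noncomputable section

/-! ### The Hilbert transform on L² -/

theorem hilbertSymbol_of_ne_zero {ξ : ℝ} (h : ξ ≠ 0) :
    hilbertSymbol ξ * hilbertSymbol ξ = -1 ∧ ‖hilbertSymbol ξ‖ = 1 := by
  rcases lt_or_gt_of_ne h with h | h
  · simp [hilbertSymbol, Real.sign_of_neg h]
  · simp [hilbertSymbol, Real.sign_of_pos h]

theorem norm_hilbertL2 (f : Lp ℂ 2 (volume : Measure ℝ)) : ‖hilbertL2 f‖ = ‖f‖ := by
  rw [← Lp.norm_fourier_eq (hilbertL2 f), ← Lp.norm_fourier_eq f, Lp.norm_def, Lp.norm_def]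
  congr 1
  refine eLpNorm_congr_norm_ae ?_
  filter_upwards [fourier_hilbertL2 f, Measure.ae_ne volume (0 : ℝ)] with ξ h h0
  rw [h, norm_mul, (hilbertSymbol_of_ne_zero h0).2, one_mul]

theorem hilbertL2_hilbertL2 (f : Lp ℂ 2 (volume : Measure ℝ)) :
    hilbertL2 (hilbertL2 f) = -f := by
  apply (Lp.fourierTransformₗᵢ ℝ ℂ).injective
  rw [map_neg]
  apply Lp.ext
  have h1 := fourier_hilbertL2 (hilbertL2 f)
  refine h1.trans ?_
  filter_upwards [fourier_hilbertL2 f, Measure.ae_ne volume (0 : ℝ),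
    Lp.coeFn_neg (Lp.fourierTransformₗᵢ ℝ ℂ f)] with ξ h h0 h3
  rw [h, h3, ← mul_assoc, (hilbertSymbol_of_ne_zero h0).1, neg_one_mul]
  rfl

-- An isometry preserves inner products; apply this to f and Hg and use H² = -I. This drives the
-- duality argument for p > 2.
open scoped ComplexInnerProductSpace in
theorem inner_hilbertL2 (f g : Lp ℂ 2 (volume : Measure ℝ)) :
    ⟪hilbertL2 f, g⟫ = -⟪f, hilbertL2 g⟫ := by
  have h : ⟪hilbertL2 f, hilbertL2 (hilbertL2 g)⟫ = ⟪f, hilbertL2 g⟫ :=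
    (LinearMap.norm_map_iff_inner_map_map hilbertL2).1 norm_hilbertL2 f (hilbertL2 g)
  rw [hilbertL2_hilbertL2, inner_neg_right] at h
  rw [← h, neg_neg]

/-! ### The L² Fourier transform as an integral on L¹ ∩ L² -/

open SchwartzMap in
/-- On `L¹ ∩ L²` the `L²` Fourier transform is given by the Fourier integral. -/
theorem coeFn_fourier_toLp {g : ℝ → ℂ} (h1 : Integrable g) (h2 : MemLp g 2 volume) :
    (𝓕 (h2.toLp g) : Lp ℂ 2 (volume : Measure ℝ)) =ᵐ[volume] 𝓕 g := by
  have hc : Continuous (𝓕 g) := VectorFourier.fourierIntegral_continuous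
    Real.continuous_fourierChar continuous_inner h1
  refine ae_eq_of_integral_contDiff_smul_eq
    ((Lp.memLp _).locallyIntegrable (by norm_num)) hc.locallyIntegrable fun φ hφ hφs => ?_
  have hφ' : ContDiff ℝ (⊤ : ℕ∞) (fun x => (φ x : ℂ)) := Complex.ofRealCLM.contDiff.comp hφ
  have hs : HasCompactSupport (fun x => (φ x : ℂ)) := hφs.comp_left Complex.ofReal_zero
  let ψ : 𝓢(ℝ, ℂ) := hs.toSchwartzMap hφ'
  have hψ : ∀ x, ψ x = φ x := fun x => rfl
  -- The L² transform agrees with the distributional one, which moves onto the test function ψ. The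
  -- multiplication formula for integrable functions (`h4`) does the same for the Fourier integral.
  have key := congrArg (fun T => T ψ) (Lp.fourier_toTemperedDistribution_eq (h2.toLp g))
  simp only [TemperedDistribution.fourier_apply, Lp.toTemperedDistribution_apply] at key
  simp only [hψ] at key
  simp only [Complex.real_smul]
  simp only [smul_eq_mul] at key
  rw [← key]
  have h3 : ∫ x, 𝓕 ψ x * (h2.toLp g) x = ∫ x, 𝓕 ψ x * g x := by
    refine integral_congr_ae ?_
    filter_upwards [h2.coeFn_toLp] with x hx
    rw [hx]
  rw [h3]
  have h4 := VectorFourier.integral_fourierIntegral_smul_eq_flip (L := innerₗ ℝ) (μ := volume)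
    (ν := volume) Real.continuous_fourierChar continuous_inner ψ.integrable h1
  rw [flip_innerₗ] at h4
  exact h4

open SchwartzMap in
/-- On `L¹ ∩ L²` the inverse `L²` Fourier transform is given by the inverse Fourier integral. -/
theorem coeFn_fourierInv_toLp {g : ℝ → ℂ} (h1 : Integrable g) (h2 : MemLp g 2 volume) :
    (𝓕⁻ (h2.toLp g) : Lp ℂ 2 (volume : Measure ℝ)) =ᵐ[volume] 𝓕⁻ g := by
  have hc : Continuous (𝓕⁻ g) := VectorFourier.fourierIntegral_continuous
    Real.continuous_fourierChar continuous_inner.neg h1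
  refine ae_eq_of_integral_contDiff_smul_eq
    ((Lp.memLp _).locallyIntegrable (by norm_num)) hc.locallyIntegrable fun φ hφ hφs => ?_
  have hφ' : ContDiff ℝ (⊤ : ℕ∞) (fun x => (φ x : ℂ)) := Complex.ofRealCLM.contDiff.comp hφ
  have hs : HasCompactSupport (fun x => (φ x : ℂ)) := hφs.comp_left Complex.ofReal_zero
  let ψ : 𝓢(ℝ, ℂ) := hs.toSchwartzMap hφ'
  have hψ : ∀ x, ψ x = φ x := fun x => rfl
  have key := congrArg (fun T => T ψ) (Lp.fourierInv_toTemperedDistribution_eq (h2.toLp g))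
  simp only [TemperedDistribution.fourierInv_apply, Lp.toTemperedDistribution_apply] at key
  simp only [hψ] at key
  simp only [Complex.real_smul]
  simp only [smul_eq_mul] at key
  rw [← key]
  have h3 : ∫ x, 𝓕⁻ ψ x * (h2.toLp g) x = ∫ x, 𝓕⁻ ψ x * g x := by
    refine integral_congr_ae ?_
    filter_upwards [h2.coeFn_toLp] with x hx
    rw [hx]
  rw [h3]
  -- The inverse transform is the Fourier integral for the pairing -⟨x, y⟩, which is again
  -- symmetric.
  have h4 := VectorFourier.integral_fourierIntegral_smul_eq_flip (L := -innerₗ ℝ) (μ := volume)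
    (ν := volume) Real.continuous_fourierChar continuous_inner.neg ψ.integrable h1
  have hL : (-innerₗ ℝ).flip = -innerₗ ℝ :=
    LinearMap.ext₂ fun x y => congrArg Neg.neg (real_inner_comm x y)
  rw [hL] at h4
  rw [SchwartzMap.fourierInv_coe]
  exact h4

/-! ### Two inequalities: powers in the right half-plane, and averages in Lᵖ -/

/-- On the right half-plane `|z|ᵖ` is dominated by `(Re z)ᵖ` up to a multiple of the harmonic
function `Re zᵖ`. -/
theorem exists_norm_rpow_le_re_rpow_sub {p : ℝ} (h1 : 1 < p) (h2 : p < 2) :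
    ∃ A B : ℝ, 0 ≤ A ∧ 0 ≤ B ∧ ∀ z : ℂ, 0 < z.re →
      ‖z‖ ^ p ≤ A * z.re ^ p - B * (z ^ (p : ℂ)).re := by
  have hpi := Real.pi_pos
  have hp0 : 0 < p := by linarith
  -- Any angle strictly between π/(2p) and π/2 would do: there cos θ > 0 while cos(pθ) < 0. The
  -- midpoint is taken.
  set θ : ℝ := (Real.pi / 2 + Real.pi / (2 * p)) / 2 with hθ
  have hdiv : Real.pi / (2 * p) < Real.pi / 2 := by
    apply div_lt_div_of_pos_left hpi <;> linarith
  have hdiv0 : 0 < Real.pi / (2 * p) := by positivity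
  have hpθ : p * (Real.pi / (2 * p)) = Real.pi / 2 := by field_simp
  have hθ2 : θ < Real.pi / 2 := by linarith
  have hθ0 : 0 < θ := by linarith
  have hpθ1 : Real.pi / 2 < p * θ := by
    have : Real.pi / (2 * p) < θ := by linarith
    calc Real.pi / 2 = p * (Real.pi / (2 * p)) := hpθ.symm
      _ < p * θ := by gcongr
  have hpθ2 : p * θ < Real.pi := by nlinarith
  have hc : Real.cos (p * θ) < 0 :=
    Real.cos_neg_of_pi_div_two_lt_of_lt hpθ1 (by linarith)
  have hcθ : 0 < Real.cos θ := Real.cos_pos_of_mem_Ioo ⟨by linarith, hθ2⟩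
  set B : ℝ := (-Real.cos (p * θ))⁻¹ with hB
  have hB0 : 0 < B := inv_pos.2 (by linarith)
  have hBc : B * Real.cos (p * θ) = -1 := by
    rw [hB]; field_simp [hc.ne]
  have hcp : 0 < Real.cos θ ^ p := Real.rpow_pos_of_pos hcθ p
  set A : ℝ := (1 + B) / Real.cos θ ^ p with hA
  have hA0 : 0 < A := by positivity
  -- By homogeneity only the argument a of z matters. For a ≤ θ, A was chosen so that the first term
  -- is at least 1 + B, which absorbs the second. For a ≥ θ, pa lies in [pθ, π], where cosine
  -- decreases, so -B cos(pa) ≥ 1.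
  have key : ∀ a : ℝ, 0 ≤ a → a < Real.pi / 2 →
      1 ≤ A * Real.cos a ^ p - B * Real.cos (p * a) := by
    intro a ha0 ha2
    have hca : 0 < Real.cos a := Real.cos_pos_of_mem_Ioo ⟨by linarith, ha2⟩
    rcases le_total a θ with h | h
    · have h3 : Real.cos θ ^ p ≤ Real.cos a ^ p :=
        Real.rpow_le_rpow hcθ.le (Real.cos_le_cos_of_nonneg_of_le_pi ha0 (by linarith) h) hp0.le
      have h4 : 1 + B ≤ A * Real.cos a ^ p := by
        calc 1 + B = A * Real.cos θ ^ p := by rw [hA]; field_simp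
          _ ≤ _ := by gcongr
      have h5 : B * Real.cos (p * a) ≤ B * 1 := by gcongr; exact Real.cos_le_one _
      linarith
    · have h3 : Real.cos (p * a) ≤ Real.cos (p * θ) :=
        Real.cos_le_cos_of_nonneg_of_le_pi (by positivity) (by nlinarith) (by gcongr)
      have h4 : B * Real.cos (p * a) ≤ -1 := hBc ▸ by gcongr
      have h5 : 0 ≤ A * Real.cos a ^ p := by positivity
      linarith
  refine ⟨A, B, hA0.le, hB0.le, fun z hz => ?_⟩
  have harg : |z.arg| < Real.pi / 2 := Complex.abs_arg_lt_pi_div_two_iff.2 (Or.inl hz)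
  have hk := key |z.arg| (abs_nonneg _) harg
  rw [Real.cos_abs, ← abs_of_pos hp0, ← abs_mul, Real.cos_abs, abs_of_pos hp0] at hk
  have hre : z.re = ‖z‖ * Real.cos z.arg := (Complex.norm_mul_cos_arg z).symm
  have hcos : 0 ≤ Real.cos z.arg := Real.cos_nonneg_of_mem_Icc
    ⟨by linarith [(abs_lt.1 harg).1], (abs_lt.1 harg).2.le⟩
  rw [Complex.cpow_ofReal_re, hre, Real.mul_rpow (norm_nonneg z) hcos, mul_comm z.arg p]
  have := mul_le_mul_of_nonneg_left hk (Real.rpow_nonneg (norm_nonneg z) p)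
  linarith

/-- Averages of translates do not increase the `Lᵖ` norm. -/
theorem lintegral_rpow_lintegral_mul_sub_le {p : ℝ} (hp : 1 < p) {g k : ℝ → ℝ≥0∞}
    (hg : Measurable g) (hk : Measurable k) (hk1 : ∫⁻ x, k x = 1) :
    ∫⁻ x, (∫⁻ t, g t * k (x - t)) ^ p ≤ ∫⁻ t, g t ^ p := by
  have hp0 : 0 < p := by linarith
  have hpq := Real.HolderConjugate.conjExponent hp
  have hq0 := hpq.symm.pos
  have hx : ∀ x, (∫⁻ t, g t * k (x - t)) ^ p ≤ ∫⁻ t, g t ^ p * k (x - t) := by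
    intro x
    have hkx : Measurable fun t => k (x - t) := hk.comp (measurable_const.sub measurable_id)
    -- Jensen by way of Hölder: write k as k^(1/p) · k^(1/q); the second factor integrates to 1.
    have h1 := ENNReal.lintegral_mul_le_Lp_mul_Lq volume hpq
      (f := fun t => g t * k (x - t) ^ (1 / p)) (g := fun t => k (x - t) ^ (1 / p.conjExponent))
      (hg.mul (hkx.pow_const _)).aemeasurable (hkx.pow_const _).aemeasurable
    have h2 : ∀ t, (g t * k (x - t) ^ (1 / p)) ^ p = g t ^ p * k (x - t) := fun t => by
      rw [ENNReal.mul_rpow_of_nonneg _ _ hp0.le, ← ENNReal.rpow_mul, one_div,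
        inv_mul_cancel₀ hp0.ne', ENNReal.rpow_one]
    have h3 : ∀ t, (k (x - t) ^ (1 / p.conjExponent)) ^ p.conjExponent = k (x - t) := fun t => by
      rw [← ENNReal.rpow_mul, one_div, inv_mul_cancel₀ hq0.ne', ENNReal.rpow_one]
    have h4 : ∀ t, g t * k (x - t) ^ (1 / p) * k (x - t) ^ (1 / p.conjExponent)
        = g t * k (x - t) := fun t => by
      rw [mul_assoc, ← ENNReal.rpow_add_of_nonneg _ _ (by positivity) (by positivity), one_div,
        one_div, hpq.inv_add_inv_eq_one, ENNReal.rpow_one]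
    simp only [Pi.mul_apply, h2, h3, h4] at h1
    rw [lintegral_sub_left_eq_self k x, hk1, ENNReal.one_rpow, mul_one] at h1
    calc (∫⁻ t, g t * k (x - t)) ^ p ≤ ((∫⁻ t, g t ^ p * k (x - t)) ^ (1 / p)) ^ p := by gcongr
      _ = _ := by rw [← ENNReal.rpow_mul, one_div, inv_mul_cancel₀ hp0.ne', ENNReal.rpow_one]
  calc _ ≤ ∫⁻ x, ∫⁻ t, g t ^ p * k (x - t) := lintegral_mono hx
    _ = ∫⁻ t, ∫⁻ x, g t ^ p * k (x - t) := by
        refine lintegral_lintegral_swap (Measurable.aemeasurable ?_)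
        exact ((hg.pow_const p).comp measurable_snd).mul
          (hk.comp (measurable_fst.sub measurable_snd))
    _ = ∫⁻ t, g t ^ p := by
        refine lintegral_congr fun t => ?_
        have hkt : Measurable fun x => k (x - t) := hk.comp (measurable_id.sub measurable_const)
        rw [lintegral_const_mul _ hkt,
          lintegral_sub_right_eq_self k t, hk1, mul_one]

theorem lintegral_poisson {y : ℝ} (hy : 0 < y) :
    ∫⁻ x : ℝ, ENNReal.ofReal (y / (Real.pi * (x ^ 2 + y ^ 2))) = 1 := by
  have h1 : ∀ x : ℝ, y / (Real.pi * (x ^ 2 + y ^ 2)) =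
      (Real.pi * y)⁻¹ * (1 + (x / y) ^ 2)⁻¹ := fun x => by
    have := Real.pi_pos
    field_simp
    ring
  have hi : Integrable fun x : ℝ => (Real.pi * y)⁻¹ * (1 + (x / y) ^ 2)⁻¹ :=
    (integrable_inv_one_add_sq.comp_div hy.ne').const_mul _
  simp_rw [h1]
  rw [← ofReal_integral_eq_lintegral_ofReal hi
    (Filter.Eventually.of_forall fun x => by have := Real.pi_pos; positivity),
    integral_const_mul, Measure.integral_comp_div (fun x : ℝ => (1 + x ^ 2)⁻¹) y,
    integral_univ_inv_one_add_sq, abs_of_pos hy, smul_eq_mul, mul_comm y,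
    inv_mul_cancel₀ (by have := Real.pi_pos; positivity), ENNReal.ofReal_one]

/-! ### The Cauchy integral and its Lᵖ bound on horizontal lines -/

open Filter Topology in
section
variable {f : ℝ → ℝ}

/-- The Cauchy integral of `f`, a holomorphic function on the upper half-plane whose real part is
the Poisson integral of `f`. -/
def cauchyTransform (f : ℝ → ℝ) (z : ℂ) : ℂ :=
  ∫ t : ℝ, (f t : ℂ) * (Complex.I / (Real.pi * (z - t)))

theorem le_norm_sub_ofReal (z : ℂ) (t : ℝ) : z.im ≤ ‖z - t‖ := by
  have := (le_abs_self _).trans (Complex.abs_im_le_norm (z - t))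
  simpa using this

theorem norm_cauchyKernel_le {z : ℂ} {t d : ℝ} (hd : 0 < d) (h : d ≤ ‖z - t‖) :
    ‖(Complex.I / (Real.pi * (z - t)) : ℂ)‖ ≤ (Real.pi * d)⁻¹ := by
  have := Real.pi_pos
  rw [norm_div, norm_mul, Complex.norm_I, Complex.norm_real, Real.norm_of_nonneg this.le, one_div]
  gcongr

theorem measurable_cauchyKernel (z : ℂ) :
    Measurable fun t : ℝ => (Complex.I / (Real.pi * (z - t)) : ℂ) := by
  fun_prop

theorem integrable_cauchyTransform (hf : Integrable f) {z : ℂ} (hz : 0 < z.im) :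
    Integrable fun t : ℝ => (f t : ℂ) * (Complex.I / (Real.pi * (z - t))) :=
  hf.ofReal.mul_bdd (measurable_cauchyKernel z).aestronglyMeasurable
    (Eventually.of_forall fun t => norm_cauchyKernel_le hz (le_norm_sub_ofReal z t))

/-- Measuring the distance to the support of f, rather than Im z, gives decay on the vertical sides
of a contour as well, where Im z may stay small. -/
theorem norm_cauchyTransform_le (hf : Integrable f) {z : ℂ} {d : ℝ} (hd : 0 < d)
    (h : ∀ t, f t ≠ 0 → d ≤ ‖z - t‖) :
    ‖cauchyTransform f z‖ ≤ (∫ t, |f t|) * (Real.pi * d)⁻¹ := by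
  rw [← integral_mul_const]
  refine norm_integral_le_of_norm_le (hf.abs.mul_const _) (Eventually.of_forall fun t => ?_)
  rw [norm_mul, Complex.norm_real, Real.norm_eq_abs]
  by_cases h0 : f t = 0
  · simp [h0]
  · gcongr
    exact norm_cauchyKernel_le hd (h t h0)

theorem re_cauchyKernel (x y t : ℝ) :
    (Complex.I / (Real.pi * ((x : ℂ) + y * Complex.I - t)) : ℂ).re =
      y / (Real.pi * ((x - t) ^ 2 + y ^ 2)) := by
  have h : (Real.pi * ((x : ℂ) + y * Complex.I - t) : ℂ) =
      ((Real.pi * (x - t) : ℝ) : ℂ) + ((Real.pi * y : ℝ) : ℂ) * Complex.I := by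
    push_cast; ring
  rw [h, Complex.div_re, Complex.normSq_add_mul_I]
  simp
  have := Real.pi_pos
  have h2 : (Real.pi * (x - t)) ^ 2 + (Real.pi * y) ^ 2 =
    Real.pi * (Real.pi * ((x - t) ^ 2 + y ^ 2)) := by ring
  rw [h2, mul_div_mul_left _ _ this.ne']

theorem re_cauchyTransform (hf : Integrable f) (x : ℝ) {y : ℝ} (hy : 0 < y) :
    (cauchyTransform f (x + y * Complex.I)).re =
      ∫ t, f t * (y / (Real.pi * ((x - t) ^ 2 + y ^ 2))) := by
  have hz : 0 < ((x : ℂ) + y * Complex.I).im := by simpa using hy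
  have h := (Complex.reCLM.integral_comp_comm (integrable_cauchyTransform hf hz)).symm
  refine (show (cauchyTransform f (x + y * Complex.I)).re = _ from h).trans ?_
  refine integral_congr_ae (Eventually.of_forall fun t => ?_)
  simp only [Complex.reCLM_apply, Complex.re_ofReal_mul, re_cauchyKernel]

theorem integrable_poisson (hf : Integrable f) (x : ℝ) {y : ℝ} (hy : 0 < y) :
    Integrable fun t => f t * (y / (Real.pi * ((x - t) ^ 2 + y ^ 2))) := by
  have hz : 0 < ((x : ℂ) + y * Complex.I).im := by simpa using hy
  refine (integrable_cauchyTransform hf hz).re.congr (Eventually.of_forall fun t => ?_)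
  simp only [RCLike.re_to_complex, Complex.re_ofReal_mul, re_cauchyKernel]

/-- The Poisson kernel is strictly positive. Positivity of the real part keeps F off the branch cut,
so that Fᵖ is holomorphic. -/
theorem re_cauchyTransform_pos (hf : Integrable f) (hf0 : 0 ≤ f) (hpos : 0 < ∫ t, f t)
    {z : ℂ} (hz : 0 < z.im) : 0 < (cauchyTransform f z).re := by
  have hk : ∀ t : ℝ, 0 < z.im / (Real.pi * ((z.re - t) ^ 2 + z.im ^ 2)) := fun t => by
    have := Real.pi_pos
    positivity
  rw [← Complex.re_add_im z, re_cauchyTransform hf _ hz,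
    integral_pos_iff_support_of_nonneg (fun t => mul_nonneg (hf0 t) (hk t).le)
      (integrable_poisson hf _ hz)]
  rw [integral_pos_iff_support_of_nonneg hf0 hf] at hpos
  convert hpos using 2
  ext t
  rw [Function.mem_support, Function.mem_support, mul_ne_zero_iff_right (hk t).ne']

theorem differentiableAt_cauchyTransform (hf : Integrable f) {z : ℂ} (hz : 0 < z.im) :
    DifferentiableAt ℂ (cauchyTransform f) z := by
  have hpi := Real.pi_pos
  have hs : {w : ℂ | z.im / 2 < w.im} ∈ 𝓝 z :=
    (isOpen_lt continuous_const Complex.continuous_im).mem_nhds (by simpa using hz)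
  refine (hasDerivAt_integral_of_dominated_loc_of_deriv_le (μ := volume) (𝕜 := ℂ)
    (F := fun w t => (f t : ℂ) * (Complex.I / (Real.pi * (w - t))))
    (F' := fun w t => (f t : ℂ) * (-Complex.I / (Real.pi * (w - t) ^ 2)))
    (bound := fun t => |f t| * (Real.pi * (z.im / 2) ^ 2)⁻¹) hs
    (Eventually.of_forall fun w =>
      hf.ofReal.aestronglyMeasurable.mul (measurable_cauchyKernel w).aestronglyMeasurable)
    (integrable_cauchyTransform hf hz)
    (hf.ofReal.aestronglyMeasurable.mul (Measurable.aestronglyMeasurable (by fun_prop)))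
    (Eventually.of_forall fun t w hw => ?_) (hf.abs.mul_const _)
    (Eventually.of_forall fun t w hw => ?_)).2.differentiableAt
  · have h1 : z.im / 2 ≤ ‖w - t‖ := (le_of_lt hw).trans (le_norm_sub_ofReal w t)
    rw [norm_mul, Complex.norm_real, Real.norm_eq_abs, norm_div, norm_neg, Complex.norm_I,
      norm_mul, Complex.norm_real, Real.norm_of_nonneg hpi.le, norm_pow, one_div]
    have : 0 < z.im / 2 := by linarith
    gcongr
  · have h1 : w - t ≠ 0 := fun h => by
      have h2 := (show z.im / 2 < w.im from hw).trans_le (le_norm_sub_ofReal w t)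
      rw [h, norm_zero] at h2
      linarith
    have hpi' : (Real.pi : ℂ) ≠ 0 := by exact_mod_cast hpi.ne'
    have h3 : HasDerivAt (fun w : ℂ => Real.pi * (w - t)) (Real.pi : ℂ) w := by
      simpa using ((hasDerivAt_id w).sub_const (t : ℂ)).const_mul (Real.pi : ℂ)
    convert! ((hasDerivAt_const w Complex.I).div h3 (mul_ne_zero hpi' h1)).const_mul (f t : ℂ)
      using 1
    field_simp
    ring

/-- Apply Cauchy's theorem to Fᵖ on the rectangle [-T, T] × [y, y + T]. When T ≥ 2R, the other three
sides are at distance at least T/2 from the support, so |F| ≤ M/T there. Their total length is 4T,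
so the integral is O(T^(1-p)), which tends to 0 because p > 1. -/
theorem tendsto_integral_cauchyTransform_cpow {p : ℝ} (hp : 1 < p) (hf : Integrable f)
    (hf0 : 0 ≤ f) (hpos : 0 < ∫ t, f t) {R : ℝ} (hR : ∀ t, f t ≠ 0 → |t| ≤ R) {y : ℝ}
    (hy : 0 < y) :
    Tendsto (fun T : ℝ => ∫ x in -T..T, cauchyTransform f (x + y * Complex.I) ^ (p : ℂ)) atTop
      (𝓝 0) := by
  have hpi := Real.pi_pos
  have hp0 : 0 < p := by linarith
  set M : ℝ := (∫ t, |f t|) * (2 / Real.pi) with hM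
  have hM0 : 0 ≤ M := mul_nonneg (integral_nonneg fun t => abs_nonneg _) (by positivity)
  set G : ℂ → ℂ := fun z => cauchyTransform f z ^ (p : ℂ) with hG
  have hGd : ∀ z : ℂ, 0 < z.im → DifferentiableAt ℂ G z := fun z hz =>
    (differentiableAt_cauchyTransform hf hz).cpow_const
      (Or.inl (re_cauchyTransform_pos hf hf0 hpos hz))
  have hGn : ∀ T : ℝ, 0 < T → ∀ z : ℂ, (∀ t, f t ≠ 0 → T / 2 ≤ ‖z - t‖) →
      ‖G z‖ ≤ (M / T) ^ p := fun T hT z hz => by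
    rw [hG, Complex.norm_cpow_real]
    refine Real.rpow_le_rpow (norm_nonneg _)
      ((norm_cauchyTransform_le hf (half_pos hT) hz).trans_eq ?_) hp0.le
    rw [hM]
    field_simp
  have hbound : ∀ T : ℝ, 0 < T → 2 * R ≤ T →
      ‖∫ x in -T..T, G (x + y * Complex.I)‖ ≤ 4 * M ^ p * T ^ (1 - p) := by
    intro T hT hRT
    have hrect := Complex.integral_boundary_rect_eq_zero_of_differentiableOn G
      (-T + y * Complex.I) (T + (y + T : ℝ) * Complex.I) (fun z hz => by
        refine (hGd z ?_).differentiableWithinAt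
        have h1 := (Complex.mem_reProdIm.1 hz).2
        simp only [Complex.add_im, Complex.neg_im, Complex.ofReal_im, Complex.mul_im,
          Complex.ofReal_re, Complex.I_im, Complex.I_re, mul_one, mul_zero, neg_zero,
          zero_add, add_zero] at h1
        rw [Set.uIcc_of_le (by linarith)] at h1
        exact hy.trans_le h1.1)
    simp only [Complex.add_re, Complex.add_im, Complex.neg_re, Complex.neg_im, Complex.ofReal_im,
      Complex.mul_im, Complex.mul_re, Complex.ofReal_re, Complex.I_im, Complex.I_re, mul_one,
      mul_zero, neg_zero, zero_add, add_zero, smul_eq_mul, sub_self] at hrect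
    have htop : ‖∫ x in -T..T, G (x + (y + T : ℝ) * Complex.I)‖ ≤ (M / T) ^ p * |T - -T| := by
      refine intervalIntegral.norm_integral_le_of_norm_le_const fun x _ => hGn T hT _ fun t _ => ?_
      refine le_trans ?_ (le_norm_sub_ofReal _ t)
      simp
      linarith
    have hside : ∀ s : ℝ, |s| = T →
        ‖∫ v in y..(y + T), G (s + v * Complex.I)‖ ≤ (M / T) ^ p * |y + T - y| := by
      intro s hs
      refine intervalIntegral.norm_integral_le_of_norm_le_const fun x _ => hGn T hT _ fun t ht => ?_
      have h1 : |s - t| ≤ ‖(s + x * Complex.I - t : ℂ)‖ := by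
        simpa using Complex.abs_re_le_norm (s + x * Complex.I - t : ℂ)
      have h2 := abs_sub_abs_le_abs_sub s t
      have h3 := hR t ht
      linarith
    have hr := hside T (abs_of_pos hT)
    have hl := hside (-T) (by rw [abs_neg, abs_of_pos hT])
    rw [Complex.ofReal_neg] at hl hrect
    have he : ∫ x in -T..T, G (x + y * Complex.I) =
        (∫ x in -T..T, G (x + (y + T : ℝ) * Complex.I)) -
        Complex.I * (∫ v in y..(y + T), G (T + v * Complex.I)) +
        Complex.I * ∫ v in y..(y + T), G (-T + v * Complex.I) := by
      linear_combination hrect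
    rw [he]
    have hpow : (M / T) ^ p * T = M ^ p * T ^ (1 - p) := by
      rw [Real.div_rpow hM0 hT.le, Real.rpow_sub hT, Real.rpow_one]
      ring
    have e1 : |T - -T| = 2 * T := by rw [abs_of_pos] <;> linarith
    have e2 : |y + T - y| = T := by rw [abs_of_pos] <;> linarith
    rw [e1] at htop
    rw [e2] at hr hl
    refine (norm_add_le _ _).trans ?_
    refine (add_le_add_left (norm_sub_le _ _) _).trans ?_
    rw [norm_mul, norm_mul, Complex.norm_I, one_mul, one_mul]
    linarith
  have hlim : Tendsto (fun T : ℝ => 4 * M ^ p * T ^ (1 - p)) atTop (𝓝 0) := by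
    have := (tendsto_rpow_neg_atTop (y := p - 1) (by linarith)).const_mul (4 * M ^ p)
    simpa using this
  refine squeeze_zero_norm' ?_ hlim
  filter_upwards [eventually_gt_atTop 0, eventually_ge_atTop (2 * R)] with T h1 h2
  exact hbound T h1 h2

/-- The real part is an average of translates of f against the Poisson kernel, which has mass 1. -/
theorem lintegral_re_cauchyTransform_rpow_le {p : ℝ} (hp : 1 < p) (hfm : Measurable f)
    (hf : Integrable f) (hf0 : 0 ≤ f) {y : ℝ} (hy : 0 < y) :
    ∫⁻ x : ℝ, ENNReal.ofReal (cauchyTransform f (x + y * Complex.I)).re ^ p ≤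
      ∫⁻ t, ENNReal.ofReal (f t) ^ p := by
  have hpi := Real.pi_pos
  have h := lintegral_rpow_lintegral_mul_sub_le hp hfm.ennreal_ofReal
    (k := fun x => ENNReal.ofReal (y / (Real.pi * (x ^ 2 + y ^ 2)))) (by fun_prop)
    (lintegral_poisson hy)
  refine le_of_eq_of_le (lintegral_congr fun x => ?_) h
  rw [re_cauchyTransform hf x hy, ofReal_integral_eq_lintegral_ofReal (integrable_poisson hf x hy)
    (Eventually.of_forall fun t => mul_nonneg (hf0 t) (by positivity))]
  simp_rw [fun t => ENNReal.ofReal_mul (q := y / (Real.pi * ((x - t) ^ 2 + y ^ 2))) (hf0 t)]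

theorem continuous_cauchyTransform_add_mul_I (hf : Integrable f) {y : ℝ} (hy : 0 < y) :
    Continuous fun x : ℝ => cauchyTransform f (x + y * Complex.I) :=
  continuous_iff_continuousAt.2 fun x =>
    (differentiableAt_cauchyTransform hf (z := x + y * Complex.I)
      (by simpa using hy)).continuousAt.comp_of_eq (by fun_prop) rfl

/-- The Cauchy integral of a nonnegative function is bounded in `Lᵖ` on horizontal lines. -/
theorem exists_lintegral_cauchyTransform_rpow_le {p : ℝ} (hp1 : 1 < p) (hp2 : p < 2) :
    ∃ A : NNReal, ∀ f : ℝ → ℝ, Measurable f → Integrable f → 0 ≤ f →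
      ∀ R, (∀ t, f t ≠ 0 → |t| ≤ R) → ∀ y : ℝ, 0 < y →
      ∫⁻ x : ℝ, ‖cauchyTransform f (x + y * Complex.I)‖ₑ ^ p ≤
        A * ∫⁻ t, ENNReal.ofReal (f t) ^ p := by
  have hp0 : 0 < p := by linarith
  obtain ⟨A, B, hA, hB, hAB⟩ := exists_norm_rpow_le_re_rpow_sub hp1 hp2
  refine ⟨A.toNNReal, fun f hfm hf hf0 R hR y hy => ?_⟩
  -- If f vanishes a.e. then so does F, and the strict positivity of Re F is lost; this case is
  -- trivial.
  rcases (integral_nonneg hf0).eq_or_lt with h0 | hpos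
  · have hz : f =ᵐ[volume] 0 := (integral_eq_zero_iff_of_nonneg hf0 hf).1 h0.symm
    have hF : ∀ z, cauchyTransform f z = 0 := fun z => by
      refine integral_eq_zero_of_ae ?_
      filter_upwards [hz] with t ht
      simp [ht]
    simp [hF, hp0]
  set F : ℝ → ℂ := fun x => cauchyTransform f (x + y * Complex.I) with hF
  have hFc : Continuous F := continuous_cauchyTransform_add_mul_I hf hy
  have hre : ∀ x, 0 < (F x).re := fun x =>
    re_cauchyTransform_pos hf hf0 hpos (by simpa using hy)
  have hc1 : Continuous fun x => ‖F x‖ ^ p := hFc.norm.rpow_const fun _ => Or.inr hp0.le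
  have hc2 : Continuous fun x => (F x).re ^ p :=
    (Complex.continuous_re.comp hFc).rpow_const fun _ => Or.inr hp0.le
  have hc3 : Continuous fun x => F x ^ (p : ℂ) := hFc.cpow continuous_const
    fun x => Or.inl (hre x)
  have hc4 : Continuous fun x => (F x ^ (p : ℂ)).re := Complex.continuous_re.comp hc3
  have hG := tendsto_integral_cauchyTransform_cpow hp1 hf hf0 hpos hR hy
  have hKle := lintegral_re_cauchyTransform_rpow_le hp1 hfm hf hf0 hy
  set K := ∫⁻ t, ENNReal.ofReal (f t) ^ p
  -- Integrate the pointwise inequality over [-T, T] and let T → ∞: the left side increases to the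
  -- full integral and the B-term disappears.
  have hlim1 := (aecover_Ioc (μ := (volume : Measure ℝ)) tendsto_neg_atTop_atBot
    tendsto_id).lintegral_tendsto_of_countably_generated
    (f := fun x => ‖F x‖ₑ ^ p) (by fun_prop)
  have hlim2 : Tendsto (fun T : ℝ => (A.toNNReal : ℝ≥0∞) * K +
      ENNReal.ofReal (B * ‖∫ x in -T..T, F x ^ (p : ℂ)‖)) atTop
      (𝓝 ((A.toNNReal : ℝ≥0∞) * K)) := by
    have h1 := (ENNReal.continuous_ofReal.tendsto _).comp (hG.norm.const_mul B)
    simpa using h1.const_add ((A.toNNReal : ℝ≥0∞) * K)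
  refine le_of_tendsto_of_tendsto hlim1 hlim2 ?_
  filter_upwards [eventually_gt_atTop 0] with T hT
  have hTT : -T ≤ T := by linarith
  have hint : ∫ x in -T..T, ‖F x‖ ^ p ≤
      A * (∫ x in -T..T, (F x).re ^ p) + B * ‖∫ x in -T..T, F x ^ (p : ℂ)‖ := by
    have h1 : ∫ x in -T..T, ‖F x‖ ^ p ≤
        ∫ x in -T..T, (A * (F x).re ^ p - B * (F x ^ (p : ℂ)).re) :=
      intervalIntegral.integral_mono_on hTT (hc1.intervalIntegrable _ _)
        (((hc2.const_mul A).sub (hc4.const_mul B)).intervalIntegrable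
          _ _) fun x _ => hAB _ (hre x)
    rw [intervalIntegral.integral_sub ((hc2.const_mul A).intervalIntegrable _ _)
      ((hc4.const_mul B).intervalIntegrable _ _),
      intervalIntegral.integral_const_mul, intervalIntegral.integral_const_mul] at h1
    have h2 : ∫ x in -T..T, (F x ^ (p : ℂ)).re = (∫ x in -T..T, F x ^ (p : ℂ)).re :=
      Complex.reCLM.intervalIntegral_comp_comm (hc3.intervalIntegrable _ _)
    have h3 : -(∫ x in -T..T, F x ^ (p : ℂ)).re ≤ ‖∫ x in -T..T, F x ^ (p : ℂ)‖ :=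
      (neg_le_abs _).trans (Complex.abs_re_le_norm _)
    rw [h2] at h1
    nlinarith [mul_le_mul_of_nonneg_left h3 hB]
  rw [intervalIntegral.integral_of_le hTT, intervalIntegral.integral_of_le hTT] at hint
  have hl : ∫⁻ x in Set.Ioc (-T) T, ‖F x‖ₑ ^ p =
      ENNReal.ofReal (∫ x in Set.Ioc (-T) T, ‖F x‖ ^ p) := by
    rw [ofReal_integral_eq_lintegral_ofReal (hc1.integrableOn_Ioc)
      (Eventually.of_forall fun x => by positivity)]
    refine lintegral_congr fun x => ?_
    rw [← ENNReal.ofReal_rpow_of_nonneg (norm_nonneg _) hp0.le, ofReal_norm]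
  have hr : ENNReal.ofReal (∫ x in Set.Ioc (-T) T, (F x).re ^ p) ≤ K := by
    rw [ofReal_integral_eq_lintegral_ofReal (hc2.integrableOn_Ioc)
      (Eventually.of_forall fun x => Real.rpow_nonneg (hre x).le p)]
    refine (setLIntegral_le_lintegral _ _).trans (le_of_eq_of_le (lintegral_congr fun x => ?_) hKle)
    rw [ENNReal.ofReal_rpow_of_nonneg (hre x).le hp0.le]
  calc ∫⁻ x in Set.Ioc (-T) T, ‖F x‖ₑ ^ p
      ≤ ENNReal.ofReal (A * (∫ x in Set.Ioc (-T) T, (F x).re ^ p) +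
          B * ‖∫ x in -T..T, F x ^ (p : ℂ)‖) := hl ▸ ENNReal.ofReal_le_ofReal hint
    _ ≤ ENNReal.ofReal A * ENNReal.ofReal (∫ x in Set.Ioc (-T) T, (F x).re ^ p) +
          ENNReal.ofReal (B * ‖∫ x in -T..T, F x ^ (p : ℂ)‖) := by
        rw [← ENNReal.ofReal_mul hA]
        exact ENNReal.ofReal_add_le
    _ ≤ _ := by gcongr; rfl

end

/-! ### Boundary values: from the Cauchy integral to f + iHf -/

open Filter Topology in
section

/-- Dominated convergence in `L²`. -/
theorem tendsto_toLp_of_dominated {g : ℕ → ℝ → ℂ} {u : ℝ → ℂ} {b : ℝ → ℂ}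
    (hg : ∀ n, MemLp (g n) 2 volume) (hu : MemLp u 2 volume) (hb : MemLp b 2 volume)
    (hgb : ∀ n x, ‖g n x‖ ≤ ‖b x‖) (hub : ∀ x, ‖u x‖ ≤ ‖b x‖)
    (hlim : ∀ x, Tendsto (fun n => g n x) atTop (𝓝 (u x))) :
    Tendsto (fun n => (hg n).toLp (g n)) atTop (𝓝 (hu.toLp u)) := by
  rw [Lp.tendsto_Lp_iff_tendsto_eLpNorm'']
  have hb2 : MemLp (fun x => (2 : ℂ) * b x) 2 volume := hb.const_mul 2
  have hfin : ∫⁻ x, ‖(2 : ℂ) * b x‖ₑ ^ (2 : ℝ) ≠ ∞ := by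
    have := lintegral_rpow_enorm_lt_top_of_eLpNorm_lt_top (by norm_num) (by norm_num) hb2.2
    simpa using this.ne
  have hlim0 : Tendsto (fun n => ∫⁻ x, ‖g n x - u x‖ₑ ^ (2 : ℝ)) atTop (𝓝 0) := by
    have h := tendsto_lintegral_of_dominated_convergence' (μ := (volume : Measure ℝ))
      (F := fun n x => ‖g n x - u x‖ₑ ^ (2 : ℝ)) (f := fun _ => 0) (fun x => ‖(2 : ℂ) * b x‖ₑ ^ (2 : ℝ))
      (fun n => ((hg n).1.sub hu.1).enorm.pow_const _) (fun n => Eventually.of_forall fun x => ?_)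
      hfin (Eventually.of_forall fun x => ?_)
    · simpa using h
    · refine ENNReal.rpow_le_rpow (enorm_le_iff_norm_le.2 ?_) (by norm_num)
      rw [norm_mul, Complex.norm_ofNat]
      linarith [norm_sub_le (g n x) (u x), hgb n x, hub x]
    · have h1 : Tendsto (fun n => ‖g n x - u x‖ₑ) atTop (𝓝 0) := by
        simpa using ((hlim x).sub_const (u x)).enorm
      have h2 := (ENNReal.continuous_rpow_const (y := 2)).tendsto 0 |>.comp h1
      simpa [Function.comp_def] using h2
  have h3 := (ENNReal.continuous_rpow_const (y := 1 / 2)).tendsto 0 |>.comp hlim0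
  simpa [Function.comp_def, eLpNorm_eq_lintegral_rpow_enorm_toReal] using h3

/-- The symbol of the map from `f` to the restriction to the line `Im z = y` of its Cauchy
integral. -/
def cauchySymbol (y ξ : ℝ) : ℂ :=
  (Set.Ioi 0).indicator (fun ξ : ℝ => 2 * Complex.exp ((-(2 * Real.pi * y) : ℝ) * ξ)) ξ

theorem measurable_cauchySymbol (y : ℝ) : Measurable (cauchySymbol y) :=
  Measurable.indicator (by fun_prop) measurableSet_Ioi

theorem norm_cauchySymbol_le {y : ℝ} (hy : 0 ≤ y) (ξ : ℝ) : ‖cauchySymbol y ξ‖ ≤ 2 := by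
  unfold cauchySymbol
  by_cases h : ξ ∈ Set.Ioi (0 : ℝ)
  · rw [Set.indicator_of_mem h, norm_mul, ← Complex.ofReal_mul, Complex.norm_exp_ofReal,
      Complex.norm_ofNat]
    have h1 : Real.exp (-(2 * Real.pi * y) * ξ) ≤ 1 := Real.exp_le_one_iff.2 (by
      have := mul_nonneg (mul_nonneg Real.two_pi_pos.le hy) (le_of_lt (Set.mem_Ioi.1 h))
      linarith)
    linarith
  · simp [Set.indicator_of_notMem h]

theorem integrable_cauchySymbol {y : ℝ} (hy : 0 < y) : Integrable (cauchySymbol y) := by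
  refine (integrable_indicator_iff measurableSet_Ioi).2
    ((integrableOn_exp_mul_complex_Ioi ?_ 0).const_mul 2)
  have := Real.pi_pos
  rw [Complex.ofReal_re]
  simp only [Left.neg_neg_iff]
  positivity

theorem continuous_cauchySymbol (ξ : ℝ) : Continuous fun y => cauchySymbol y ξ := by
  unfold cauchySymbol
  by_cases h : ξ ∈ Set.Ioi (0 : ℝ)
  · simp only [Set.indicator_of_mem h]
    fun_prop
  · simp only [Set.indicator_of_notMem h]
    fun_prop

/-- Both sides are 1 + sign ξ. At ξ = 0 they differ: the indicator gives 0, the right side 1. -/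
theorem cauchySymbol_zero {ξ : ℝ} (h : ξ ≠ 0) :
    cauchySymbol 0 ξ = 1 + Complex.I * hilbertSymbol ξ := by
  unfold cauchySymbol hilbertSymbol
  rcases lt_or_gt_of_ne h with h | h
  · rw [Set.indicator_of_notMem (by simpa using h.le), Real.sign_of_neg h]
    simp
  · rw [Set.indicator_of_mem (by simpa using h), Real.sign_of_pos h, ← mul_assoc, mul_neg,
      Complex.I_mul_I]
    norm_num

/-- The Cauchy kernel is itself the Fourier transform of k, an exponential on the half-line that
decays because y > 0. The multiplication formula moves the transform from k to f, so no inversion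
theorem is needed. -/
theorem cauchyTransform_eq_fourierInv {f : ℝ → ℝ} (hf : Integrable f) (x : ℝ) {y : ℝ}
    (hy : 0 < y) :
    cauchyTransform f (x + y * Complex.I) =
      𝓕⁻ (fun ξ => cauchySymbol y ξ * 𝓕 (fun t => (f t : ℂ)) ξ) x := by
  have hpi := Real.pi_pos
  set k : ℝ → ℂ := fun ξ => Complex.exp (2 * Real.pi * ξ * x * Complex.I) * cauchySymbol y ξ
    with hk
  have hki : Integrable k := by
    refine (integrable_cauchySymbol hy).bdd_mul (c := 1) (Measurable.aestronglyMeasurable (by fun_prop))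
      (Eventually.of_forall fun ξ => le_of_eq ?_)
    have : (2 * Real.pi * ξ * x * Complex.I : ℂ) = ((2 * Real.pi * ξ * x : ℝ) : ℂ) * Complex.I := by
      push_cast; ring
    rw [this, Complex.norm_exp_ofReal_mul_I]
  have hkF : ∀ t : ℝ, 𝓕 k t = Complex.I / (Real.pi * (x + y * Complex.I - t)) := by
    intro t
    set a : ℂ := 2 * Real.pi * Complex.I * (x + y * Complex.I - t) with ha
    have har : a.re < 0 := by
      have : a.re = -(2 * Real.pi * y) := by simp [ha]
      rw [this]
      have : 0 < 2 * Real.pi * y := by positivity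
      linarith
    have h1 : 𝓕 k t = ∫ ξ in Set.Ioi (0 : ℝ), 2 * Complex.exp (a * ξ) := by
      rw [Real.fourier_real_eq_integral_exp_smul, ← integral_indicator measurableSet_Ioi]
      refine integral_congr_ae (Eventually.of_forall fun ξ => ?_)
      simp only [hk, cauchySymbol, smul_eq_mul]
      by_cases h : ξ ∈ Set.Ioi (0 : ℝ)
      · simp only [Set.indicator_of_mem h]
        rw [mul_left_comm, ← mul_assoc, mul_left_comm, ← Complex.exp_add,
          ← Complex.exp_add]
        congr 2
        rw [ha]
        push_cast
        linear_combination (-2 * Real.pi * y * ξ : ℂ) * Complex.I_sq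
      · simp only [Set.indicator_of_notMem h, mul_zero]
    rw [h1, integral_const_mul, integral_exp_mul_complex_Ioi har]
    have hpi' : (Real.pi : ℂ) ≠ 0 := by exact_mod_cast hpi.ne'
    have hne : (x + y * Complex.I - t : ℂ) ≠ 0 := fun h => by
      rw [ha, h] at har
      simp at har
    simp only [Complex.ofReal_zero, mul_zero, Complex.exp_zero]
    rw [ha]
    field_simp
    rw [Complex.I_sq]
    ring
  have hflip := VectorFourier.integral_fourierIntegral_smul_eq_flip (L := innerₗ ℝ) (μ := volume)
    (ν := volume) Real.continuous_fourierChar continuous_inner hki (hf.ofReal (𝕜 := ℂ))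
  rw [flip_innerₗ] at hflip
  have hflip' : ∫ t, 𝓕 k t * (f t : ℂ) = ∫ ξ, k ξ * 𝓕 (fun t => (f t : ℂ)) ξ := hflip
  rw [Real.fourierInv_eq', cauchyTransform]
  calc _ = ∫ t, 𝓕 k t * (f t : ℂ) := by simp_rw [hkF, mul_comm]
    _ = _ := hflip'
    _ = _ := by
      refine integral_congr_ae (Eventually.of_forall fun ξ => ?_)
      simp only [hk, smul_eq_mul, ← mul_assoc]
      congr 3
      simp
      ring

/-- The `Lᵖ` bound for the analytic signal `f + i H f` of a nonnegative function with compact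
support. -/
theorem exists_eLpNorm_add_hilbertL2_le {p : ℝ} (hp1 : 1 < p) (hp2 : p < 2) :
    ∃ A : NNReal, ∀ f : ℝ → ℝ, Measurable f → Integrable f → 0 ≤ f →
      ∀ R, (∀ t, f t ≠ 0 → |t| ≤ R) → ∀ h2 : MemLp (fun t => (f t : ℂ)) 2 volume,
      eLpNorm (h2.toLp _ + Complex.I • hilbertL2 (h2.toLp _) : Lp ℂ 2 (volume : Measure ℝ))
        (ENNReal.ofReal p) volume ≤ A * eLpNorm f (ENNReal.ofReal p) volume := by
  have hp0 : 0 < p := by linarith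
  obtain ⟨A, hA⟩ := exists_lintegral_cauchyTransform_rpow_le hp1 hp2
  refine ⟨A ^ (1 / p), fun f hfm hf hf0 R hR h2 => ?_⟩
  set φ := h2.toLp (fun t => (f t : ℂ))
  set û : ℝ → ℂ := 𝓕 (fun t => (f t : ℂ))
  have hûφ : (𝓕 φ : Lp ℂ 2 (volume : Measure ℝ)) =ᵐ[volume] û :=
    coeFn_fourier_toLp hf.ofReal h2
  have hû2 : MemLp û 2 volume := (memLp_congr_ae hûφ).1 (Lp.memLp _)
  have hûb : ∀ ξ, ‖û ξ‖ ≤ ∫ t, ‖(f t : ℂ)‖ := fun ξ =>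
    VectorFourier.norm_fourierIntegral_le_integral_norm _ _ _ _ _
  have hg2 : ∀ y, 0 ≤ y → MemLp (fun ξ => cauchySymbol y ξ * û ξ) 2 volume := fun y hy =>
    (hû2.const_mul 2).of_le ((measurable_cauchySymbol y).aestronglyMeasurable.mul hû2.1)
      (Eventually.of_forall fun ξ => by
        rw [norm_mul, norm_mul, Complex.norm_ofNat]
        exact mul_le_mul_of_nonneg_right (norm_cauchySymbol_le hy ξ) (norm_nonneg _))
  have hg1 : ∀ y, 0 < y → Integrable (fun ξ => cauchySymbol y ξ * û ξ) := fun y hy =>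
    (integrable_cauchySymbol hy).mul_bdd hû2.1 (Eventually.of_forall hûb)
  let y : ℕ → ℝ := fun n => 1 / ((n : ℝ) + 1)
  have hy : ∀ n, 0 < y n := fun n => Nat.one_div_pos_of_nat
  have hylim : Tendsto y atTop (𝓝 0) := tendsto_one_div_add_atTop_nhds_zero_nat
  have hlim : Tendsto (fun n => (hg2 (y n) (hy n).le).toLp _) atTop
      (𝓝 ((hg2 0 le_rfl).toLp _)) := by
    refine tendsto_toLp_of_dominated _ _ (hû2.const_mul 2) (fun n ξ => ?_) (fun ξ => ?_)
      (fun ξ => ?_)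
    · rw [norm_mul, norm_mul, Complex.norm_ofNat]
      exact mul_le_mul_of_nonneg_right (norm_cauchySymbol_le (hy n).le ξ) (norm_nonneg _)
    · rw [norm_mul, norm_mul, Complex.norm_ofNat]
      exact mul_le_mul_of_nonneg_right (norm_cauchySymbol_le le_rfl ξ) (norm_nonneg _)
    · exact (((continuous_cauchySymbol ξ).tendsto 0).comp hylim).mul_const _
  have hlim' := ((Lp.fourierTransformₗᵢ ℝ ℂ).symm.continuous.tendsto _).comp hlim
  have hid : (Lp.fourierTransformₗᵢ ℝ ℂ).symm ((hg2 0 le_rfl).toLp _) =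
      φ + Complex.I • hilbertL2 φ := by
    rw [LinearIsometryEquiv.symm_apply_eq, map_add, map_smul]
    refine Lp.ext ?_
    have e1 : Lp.fourierTransformₗᵢ ℝ ℂ φ = (𝓕 φ : Lp ℂ 2 (volume : Measure ℝ)) := rfl
    have e2 : Lp.fourierTransformₗᵢ ℝ ℂ (hilbertL2 φ) =
      (𝓕 (hilbertL2 φ) : Lp ℂ 2 (volume : Measure ℝ)) := rfl
    rw [e1, e2]
    filter_upwards [(hg2 0 le_rfl).coeFn_toLp, hûφ, fourier_hilbertL2 φ,
      Measure.ae_ne volume (0 : ℝ),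
      Lp.coeFn_add (𝓕 φ : Lp ℂ 2 (volume : Measure ℝ)) (Complex.I • 𝓕 (hilbertL2 φ)),
      Lp.coeFn_smul Complex.I (𝓕 (hilbertL2 φ) : Lp ℂ 2 (volume : Measure ℝ))]
      with ξ h1 h2 h3 h4 h5 h6
    rw [h1, h5, Pi.add_apply, h6, Pi.smul_apply, h3, h2, cauchySymbol_zero h4, smul_eq_mul]
    ring
  rw [← hid]
  -- L² convergence implies convergence in measure, under which the Lᵖ norm is lower semicontinuous;
  -- the bound on the lines does not depend on the height.
  refine eLpNorm_le_of_tendstoInMeasure (Eventually.of_forall fun n => ?_)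
    (tendstoInMeasure_of_tendsto_Lp hlim') (fun n => Lp.aestronglyMeasurable _)
  have hn : ((Lp.fourierTransformₗᵢ ℝ ℂ).symm ((hg2 (y n) (hy n).le).toLp _) :
      Lp ℂ 2 (volume : Measure ℝ)) =ᵐ[volume]
      fun x : ℝ => cauchyTransform f (x + y n * Complex.I) := by
    refine (coeFn_fourierInv_toLp (hg1 _ (hy n)) (hg2 _ (hy n).le)).trans
      (Eventually.of_forall fun x => ?_)
    exact (cauchyTransform_eq_fourierInv hf x (hy n)).symm
  refine (eLpNorm_congr_ae hn).trans_le ?_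
  rw [eLpNorm_eq_lintegral_rpow_enorm_toReal (by simpa using hp0) ENNReal.ofReal_ne_top,
    eLpNorm_eq_lintegral_rpow_enorm_toReal (by simpa using hp0) ENNReal.ofReal_ne_top,
    ENNReal.toReal_ofReal hp0.le, ENNReal.coe_rpow_of_nonneg _ (by positivity),
    ← ENNReal.mul_rpow_of_nonneg _ _ (by positivity)]
  refine ENNReal.rpow_le_rpow ((hA f hfm hf hf0 R hR _ (hy n)).trans_eq ?_) (by positivity)
  simp_rw [fun t => Real.enorm_of_nonneg (hf0 t)]

end

/-! ### Extension from L² ∩ Lᵖ to Lᵖ -/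

section

/-- `hilbertL2` is bounded in the `Lᵖ` norm on `L² ∩ Lᵖ`. -/
def IsHilbertBounded (p : ℝ≥0∞) : Prop :=
  ∃ C : NNReal, ∀ f : Lp ℂ 2 (volume : Measure ℝ), MemLp f p volume →
    eLpNorm (hilbertL2 f) p volume ≤ C * eLpNorm f p volume

theorem IsHilbertBounded.memLp {p : ℝ≥0∞} (h : IsHilbertBounded p)
    {f : Lp ℂ 2 (volume : Measure ℝ)} (hf : MemLp f p volume) :
    MemLp (hilbertL2 f) p volume := by
  obtain ⟨C, hC⟩ := h
  exact ⟨(Lp.memLp _).1, (hC f hf).trans_lt (ENNReal.mul_lt_top ENNReal.coe_lt_top hf.2)⟩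

/-- The subspace `L² ∩ Lᵖ` of `L²`. -/
def l2InterLp (p : ℝ≥0∞) : Submodule ℂ (Lp ℂ 2 (volume : Measure ℝ)) where
  carrier := {f | MemLp f p volume}
  add_mem' {f g} hf hg := (memLp_congr_ae (Lp.coeFn_add f g)).2 (MemLp.add hf hg)
  zero_mem' := (memLp_congr_ae (Lp.coeFn_zero _ _ _)).2 MemLp.zero
  smul_mem' c f hf := (memLp_congr_ae (Lp.coeFn_smul c f)).2 (MemLp.const_smul hf c)

theorem memLp_l2InterLp {p : ℝ≥0∞} (f : l2InterLp p) : MemLp f.1 p volume := f.2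

variable {p : ℝ≥0∞} [Fact (1 ≤ p)]

/-- The inclusion of `L² ∩ Lᵖ` in `Lᵖ`. -/
def l2InterLpToLp (p : ℝ≥0∞) [Fact (1 ≤ p)] :
    l2InterLp p →ₗ[ℂ] Lp ℂ p (volume : Measure ℝ) where
  toFun f := MemLp.toLp f.1 (memLp_l2InterLp f)
  map_add' f g := (MemLp.toLp_congr _ ((memLp_l2InterLp f).add (memLp_l2InterLp g)) (Lp.coeFn_add f.1 g.1)).trans
    (MemLp.toLp_add _ _)
  map_smul' c f := (MemLp.toLp_congr _ ((memLp_l2InterLp f).const_smul c) (Lp.coeFn_smul c f.1)).trans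
    (MemLp.toLp_const_smul _ _)

theorem coeFn_l2InterLpToLp (f : l2InterLp p) : l2InterLpToLp p f =ᵐ[volume] f.1 :=
  MemLp.coeFn_toLp (memLp_l2InterLp f)

theorem norm_l2InterLpToLp (f : l2InterLp p) :
    ‖l2InterLpToLp p f‖ = (eLpNorm f.1 p volume).toReal :=
  Lp.norm_toLp f.1 (memLp_l2InterLp f)

theorem exists_l2InterLpToLp_eq {f : Lp ℂ p (volume : Measure ℝ)} (h : MemLp f 2 volume) :
    ∃ g : l2InterLp p, g.1 = h.toLp f ∧ l2InterLpToLp p g = f :=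
  ⟨⟨h.toLp f, (memLp_congr_ae h.coeFn_toLp).2 (Lp.memLp f)⟩, rfl,
    Lp.ext ((coeFn_l2InterLpToLp _).trans h.coeFn_toLp)⟩

/-- Simple functions are dense in Lᵖ. For a finite nonzero exponent their membership amounts to
integrability, so those in Lᵖ also lie in L². -/
theorem denseRange_l2InterLpToLp (hp : p ≠ ∞) : DenseRange (l2InterLpToLp p) := by
  have hp0 : p ≠ 0 := (zero_lt_one.trans_le (Fact.out : 1 ≤ p)).ne'
  refine (Lp.simpleFunc.dense (E := ℂ) (μ := (volume : Measure ℝ)) hp).mono ?_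
  intro f hf
  have h2 : MemLp f 2 volume := by
    have h1 := Lp.simpleFunc.toSimpleFunc_eq_toFun (⟨f, hf⟩ : Lp.simpleFunc ℂ p volume)
    refine (memLp_congr_ae h1).1 ?_
    exact (SimpleFunc.memLp_iff_integrable (p := 2) (by norm_num) (by norm_num)).2
      ((SimpleFunc.memLp_iff_integrable hp0 hp).1 (Lp.simpleFunc.memLp _))
  obtain ⟨g, -, hg⟩ := exists_l2InterLpToLp_eq h2
  exact ⟨g, hg⟩

/-- The Hilbert transform on `L² ∩ Lᵖ`. -/
def hilbertInter (h : IsHilbertBounded p) : l2InterLp p →ₗ[ℂ] l2InterLp p :=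
  hilbertL2.toLinearMap.restrict fun _ hf => h.memLp hf

omit [Fact (1 ≤ p)] in
theorem hilbertInter_hilbertInter (h : IsHilbertBounded p) (f : l2InterLp p) :
    hilbertInter h (hilbertInter h f) = -f :=
  Subtype.ext (hilbertL2_hilbertL2 f.1)

/-- Turns the a.e. statement about representatives into an operator identity on a dense subspace,
the form suited to continuity arguments. -/
theorem extendsHilbertL2_iff (h : IsHilbertBounded p)
    (T : Lp ℂ p (volume : Measure ℝ) →L[ℂ] Lp ℂ p (volume : Measure ℝ)) :
    ExtendsHilbertL2 p T ↔
      ∀ f, T (l2InterLpToLp p f) = l2InterLpToLp p (hilbertInter h f) := by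
  constructor
  · intro hT f
    refine Lp.ext ((hT f.1 (Lp.memLp _) f.2).trans ?_)
    rw [Lp.toLp_coeFn]
    exact (coeFn_l2InterLpToLp (hilbertInter h f)).symm
  · intro hT f hf2 hfp
    have hm : MemLp (hf2.toLp f) p volume := (memLp_congr_ae hf2.coeFn_toLp).2 hfp
    have he : hfp.toLp f = l2InterLpToLp p ⟨hf2.toLp f, hm⟩ :=
      MemLp.toLp_congr _ hm hf2.coeFn_toLp.symm
    rw [he, hT]
    exact coeFn_l2InterLpToLp _

theorem exists_extendsHilbertL2 (hp : p ≠ ∞) (h : IsHilbertBounded p) :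
    ∃ T, ExtendsHilbertL2 p T := by
  have hb : ∃ C : ℝ, ∀ f, ‖(l2InterLpToLp p ∘ₗ hilbertInter h) f‖ ≤ C * ‖l2InterLpToLp p f‖ := by
    obtain ⟨C, hC⟩ := id h
    refine ⟨C, fun f => ?_⟩
    rw [LinearMap.comp_apply, norm_l2InterLpToLp, norm_l2InterLpToLp]
    have := ENNReal.toReal_mono (ENNReal.mul_ne_top ENNReal.coe_ne_top (memLp_l2InterLp f).2.ne)
      (hC f.1 (memLp_l2InterLp f))
    rwa [ENNReal.toReal_mul, ENNReal.coe_toReal] at this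
  have hT := LinearMap.extendOfNorm_eq (f := l2InterLpToLp p ∘ₗ hilbertInter h)
    (denseRange_l2InterLpToLp hp) hb
  exact ⟨_, (extendsHilbertL2_iff h _).2 hT⟩

theorem extendsHilbertL2_hilbertTransform (hp : p ≠ ∞) (h : IsHilbertBounded p) :
    ExtendsHilbertL2 p (hilbertTransform p) := by
  have hT := exists_extendsHilbertL2 hp h
  rw [hilbertTransform, dif_pos hT]
  exact hT.choose_spec

theorem ExtendsHilbertL2.eq (hp : p ≠ ∞) (h : IsHilbertBounded p)
    {S T : Lp ℂ p (volume : Measure ℝ) →L[ℂ] Lp ℂ p (volume : Measure ℝ)}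
    (hS : ExtendsHilbertL2 p S) (hT : ExtendsHilbertL2 p T) : S = T := by
  refine ContinuousLinearMap.coeFn_injective
    ((denseRange_l2InterLpToLp hp).equalizer S.continuous T.continuous (funext fun f => ?_))
  exact ((extendsHilbertL2_iff h S).1 hS f).trans ((extendsHilbertL2_iff h T).1 hT f).symm

/-- The dense subspace is invariant under H, so the L² identity can be applied twice there and
extended by continuity. -/
theorem ExtendsHilbertL2.comp_self (hp : p ≠ ∞) (h : IsHilbertBounded p)
    {T : Lp ℂ p (volume : Measure ℝ) →L[ℂ] Lp ℂ p (volume : Measure ℝ)}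
    (hT : ExtendsHilbertL2 p T) :
    T ∘L T = -ContinuousLinearMap.id ℂ (Lp ℂ p (volume : Measure ℝ)) := by
  refine ContinuousLinearMap.coeFn_injective
    ((denseRange_l2InterLpToLp hp).equalizer (ContinuousLinearMap.continuous _)
      (ContinuousLinearMap.continuous _) (funext fun f => ?_))
  have hT' := (extendsHilbertL2_iff h T).1 hT
  change T (T (l2InterLpToLp p f)) = -l2InterLpToLp p f
  rw [hT', hT', hilbertInter_hilbertInter, map_neg]

/-! ### The group law -/

theorem fHT_zero (p : ℝ≥0∞) [Fact (1 ≤ p)] : fHT p 0 = ContinuousLinearMap.id ℂ _ := by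
  simp [fHT]

/-- As H² = -I, the product expands like that of cos a - i sin a and cos b - i sin b, and the
addition formulas apply. -/
theorem fHT_comp_fHT
    (h : hilbertTransform p ∘L hilbertTransform p = -ContinuousLinearMap.id ℂ _) (a b : ℝ) :
    fHT p a ∘L fHT p b = fHT p (a + b) := by
  ext1 f
  have hf : hilbertTransform p (hilbertTransform p f) = -f := congrArg (fun T => T f) h
  simp only [fHT, ContinuousLinearMap.comp_apply, sub_apply,
    smul_apply, ContinuousLinearMap.id_apply, map_sub, map_smul, hf,
    mul_add, Real.cos_add, Real.sin_add]
  push_cast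
  module

/-- The automorphism `H_τ` of `Lᵖ(ℝ)`, with inverse `H_{-τ}`. -/
def fHTEquiv (h : hilbertTransform p ∘L hilbertTransform p = -ContinuousLinearMap.id ℂ _)
    (τ : ℝ) : Lp ℂ p (volume : Measure ℝ) ≃L[ℂ] Lp ℂ p (volume : Measure ℝ) :=
  ContinuousLinearEquiv.equivOfInverse' (fHT p τ) (fHT p (-τ))
    (by rw [fHT_comp_fHT h, add_neg_cancel, fHT_zero])
    (by rw [fHT_comp_fHT h, neg_add_cancel, fHT_zero])

/-- The homomorphism `τ ↦ H_τ` from `ℝ` to the automorphisms of `Lᵖ(ℝ)`. -/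
def fHTHom (h : hilbertTransform p ∘L hilbertTransform p = -ContinuousLinearMap.id ℂ _) :
    Multiplicative ℝ →* (Lp ℂ p (volume : Measure ℝ) ≃L[ℂ] Lp ℂ p (volume : Measure ℝ)) where
  toFun τ := fHTEquiv h τ.toAdd
  map_one' := ContinuousLinearEquiv.coe_injective (fHT_zero p)
  map_mul' a b := ContinuousLinearEquiv.coe_injective
    (fHT_comp_fHT h a.toAdd b.toAdd).symm

end

/-! ### Boundedness on Lᵖ for 1 < p < ∞ -/

open Filter Topology in
section

theorem integrable_of_memLp_two_of_bounded_support {v : ℝ → ℂ} (h : MemLp v 2 volume) {R : ℝ}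
    (hR : ∀ t, v t ≠ 0 → |t| ≤ R) : Integrable v := by
  have hv : (Set.Icc (-R) R).indicator v = v :=
    Set.indicator_eq_self.2 fun t ht => abs_le.1 (hR t ht)
  rw [← hv, integrable_indicator_iff measurableSet_Icc]
  exact (h.restrict _).integrable (by norm_num)

/-- From Hf = -i((f + iHf) - f) the constant grows to A + 1. It does not depend on the support, so
truncations to [-n, n] pass to the limit by L² continuity and Fatou. -/
theorem exists_eLpNorm_hilbertL2_le_of_nonneg {p : ℝ} (hp1 : 1 < p) (hp2 : p < 2) :
    ∃ A : NNReal, ∀ f : ℝ → ℝ, Measurable f → 0 ≤ f →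
      ∀ h2 : MemLp (fun t => (f t : ℂ)) 2 volume,
      eLpNorm (hilbertL2 (h2.toLp _)) (ENNReal.ofReal p) volume ≤
        A * eLpNorm f (ENNReal.ofReal p) volume := by
  obtain ⟨A, hA⟩ := exists_eLpNorm_add_hilbertL2_le hp1 hp2
  refine ⟨A + 1, fun f hfm hf0 h2 => ?_⟩
  let S : ℕ → Set ℝ := fun n => Set.Icc (-(n : ℝ)) n
  let g : ℕ → ℝ → ℝ := fun n => (S n).indicator f
  have hgf : ∀ n t, ‖g n t‖ ≤ ‖f t‖ := fun n t => norm_indicator_le_norm_self f t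
  have hgm : ∀ n, Measurable (g n) := fun n => hfm.indicator measurableSet_Icc
  have hg2 : ∀ n, MemLp (fun t => (g n t : ℂ)) 2 volume := fun n =>
    h2.of_le (Complex.measurable_ofReal.comp (hgm n)).aestronglyMeasurable
      (Eventually.of_forall fun t => by
        rw [Complex.norm_real, Complex.norm_real]; exact hgf n t)
  have hgR : ∀ n t, g n t ≠ 0 → |t| ≤ n := fun n t ht =>
    abs_le.2 (show t ∈ S n from Set.mem_of_indicator_ne_zero ht)
  have hgi : ∀ n, Integrable (g n) := fun n => by
    have := (integrable_of_memLp_two_of_bounded_support (hg2 n)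
      (fun t ht => hgR n t (by exact_mod_cast ht))).re
    simpa using this
  have hlim : Tendsto (fun n => (hg2 n).toLp _) atTop (𝓝 (h2.toLp _)) := by
    refine tendsto_toLp_of_dominated _ _ h2 (fun n t => ?_) (fun t => le_rfl) (fun t => ?_)
    · rw [Complex.norm_real, Complex.norm_real]; exact hgf n t
    · refine tendsto_const_nhds.congr' ?_
      obtain ⟨N, hN⟩ := exists_nat_ge |t|
      filter_upwards [eventually_ge_atTop N] with n hn
      have : t ∈ S n := abs_le.1 (hN.trans (by exact_mod_cast hn))
      simp only [g, Set.indicator_of_mem this]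
  have hlim' := (hilbertL2.continuous.tendsto _).comp hlim
  refine eLpNorm_le_of_tendstoInMeasure (Eventually.of_forall fun n => ?_)
    (tendstoInMeasure_of_tendsto_Lp hlim') (fun n => Lp.aestronglyMeasurable _)
  set φ := (hg2 n).toLp _
  have hp1' : 1 ≤ ENNReal.ofReal p := ENNReal.one_le_ofReal.2 hp1.le
  have h1 := hA (g n) (hgm n) (hgi n) (Set.indicator_nonneg fun t _ => hf0 t) n (hgR n) (hg2 n)
  have h3 : (hilbertL2 φ : ℝ → ℂ) =ᵐ[volume]
      (-Complex.I) • (((φ + Complex.I • hilbertL2 φ : Lp ℂ 2 (volume : Measure ℝ)) : ℝ → ℂ) -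
        (φ : ℝ → ℂ)) := by
    filter_upwards [Lp.coeFn_add φ (Complex.I • hilbertL2 φ),
      Lp.coeFn_smul Complex.I (hilbertL2 φ)] with t e1 e2
    rw [Pi.smul_apply, Pi.sub_apply, e1, Pi.add_apply, e2, Pi.smul_apply, smul_eq_mul, smul_eq_mul]
    linear_combination (hilbertL2 φ : ℝ → ℂ) t * Complex.I_sq
  have h4 : eLpNorm φ (ENNReal.ofReal p) volume = eLpNorm (g n) (ENNReal.ofReal p) volume := by
    rw [eLpNorm_congr_ae (hg2 n).coeFn_toLp]
    exact eLpNorm_congr_norm_ae (Eventually.of_forall fun t => Complex.norm_real _)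
  change eLpNorm (hilbertL2 φ) _ _ ≤ _
  rw [eLpNorm_congr_ae h3, eLpNorm_const_smul, enorm_neg, ← ofReal_norm, Complex.norm_I,
    ENNReal.ofReal_one, one_mul]
  calc _ ≤ _ := eLpNorm_sub_le (Lp.aestronglyMeasurable _) (Lp.aestronglyMeasurable _) hp1'
    _ ≤ A * eLpNorm (g n) (ENNReal.ofReal p) volume +
          eLpNorm (g n) (ENNReal.ofReal p) volume := add_le_add h1 h4.le
    _ = ((A + 1 : NNReal) : ℝ≥0∞) * eLpNorm (g n) (ENNReal.ofReal p) volume := by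
        push_cast; ring
    _ ≤ _ := by gcongr; exact eLpNorm_mono (hgf n)

theorem isHilbertBounded_of_lt_two {p : ℝ} (hp1 : 1 < p) (hp2 : p < 2) :
    IsHilbertBounded (ENNReal.ofReal p) := by
  obtain ⟨A, hA⟩ := exists_eLpNorm_hilbertL2_le_of_nonneg hp1 hp2
  have hp1' : 1 ≤ ENNReal.ofReal p := ENNReal.one_le_ofReal.2 hp1.le
  refine ⟨4 * A, fun φ _ => ?_⟩
  have hφm : Measurable (φ : ℝ → ℂ) := (Lp.stronglyMeasurable φ).measurable
  -- For c = 1, -1, -i, i these are the positive and negative parts of Re φ and of Im φ; four pieces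
  -- give the constant 4A.
  let v : ℂ → ℝ → ℝ := fun c t => max (c * φ t).re 0
  have hv0 : ∀ c, 0 ≤ v c := fun c t => le_max_right _ _
  have hvm : ∀ c, Measurable (v c) := fun c =>
    (Complex.measurable_re.comp (hφm.const_mul c)).max measurable_const
  have hvle : ∀ c, ‖c‖ = 1 → ∀ t, ‖v c t‖ ≤ ‖(φ : ℝ → ℂ) t‖ := fun c hc t => by
    rw [Real.norm_of_nonneg (hv0 c t)]
    refine max_le ((Complex.re_le_norm _).trans_eq ?_) (norm_nonneg _)
    rw [norm_mul, hc, one_mul]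
  have hv2 : ∀ c, ‖c‖ = 1 → MemLp (fun t => (v c t : ℂ)) 2 volume := fun c hc =>
    (Lp.memLp φ).of_le (Complex.measurable_ofReal.comp (hvm c)).aestronglyMeasurable
      (Eventually.of_forall fun t => by rw [Complex.norm_real]; exact hvle c hc t)
  have hH : ∀ (c : ℂ) (hc : ‖c‖ = 1),
      eLpNorm (hilbertL2 ((hv2 c hc).toLp _)) (ENNReal.ofReal p) volume ≤
        A * eLpNorm φ (ENNReal.ofReal p) volume := fun c hc =>
    (hA (v c) (hvm c) (hv0 c) (hv2 c hc)).trans (by gcongr; exact eLpNorm_mono (hvle c hc))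
  have n1 : ‖(1 : ℂ)‖ = 1 := norm_one
  have n2 : ‖(-1 : ℂ)‖ = 1 := by simp
  have n3 : ‖-Complex.I‖ = 1 := by simp
  have n4 : ‖Complex.I‖ = 1 := by simp
  have hsplit : φ = ((hv2 1 n1).toLp _ - (hv2 (-1) n2).toLp _) +
      Complex.I • ((hv2 (-Complex.I) n3).toLp _ - (hv2 Complex.I n4).toLp _) := by
    have hmax : ∀ r : ℝ, max r 0 - max (-r) 0 = r := fun r => by
      rcases le_total 0 r with h | h
      · rw [max_eq_left h, max_eq_right (by linarith)]; ring
      · rw [max_eq_right h, max_eq_left (by linarith)]; ring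
    rw [← MemLp.toLp_sub, ← MemLp.toLp_sub, ← MemLp.toLp_const_smul, ← MemLp.toLp_add]
    refine Lp.ext (EventuallyEq.trans (Eventually.of_forall fun t => ?_)
      (MemLp.coeFn_toLp _).symm)
    simp only [v, Pi.add_apply, Pi.sub_apply, Pi.smul_apply, smul_eq_mul, one_mul, neg_mul,
      Complex.neg_re, Complex.I_mul_re, neg_neg, ← Complex.ofReal_sub, hmax]
    rw [mul_comm, Complex.re_add_im]
  set a := hilbertL2 ((hv2 1 n1).toLp _)
  set b := hilbertL2 ((hv2 (-1) n2).toLp _)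
  set c := hilbertL2 ((hv2 (-Complex.I) n3).toLp _)
  set d := hilbertL2 ((hv2 Complex.I n4).toLp _)
  have hHφ : hilbertL2 φ = (a - b) + Complex.I • (c - d) := by
    conv_lhs => rw [hsplit]
    rw [map_add, map_smul, map_sub, map_sub]
  have hae : (hilbertL2 φ : ℝ → ℂ) =ᵐ[volume]
      ((a : ℝ → ℂ) - b) + Complex.I • ((c : ℝ → ℂ) - d) := by
    rw [hHφ]
    exact (Lp.coeFn_add _ _).trans ((Lp.coeFn_sub a b).add
      ((Lp.coeFn_smul _ _).trans ((Lp.coeFn_sub c d).const_smul Complex.I)))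
  have hm : ∀ u : Lp ℂ 2 (volume : Measure ℝ), AEStronglyMeasurable (u : ℝ → ℂ) volume :=
    fun u => Lp.aestronglyMeasurable u
  rw [eLpNorm_congr_ae hae]
  refine (eLpNorm_add_le ((hm a).sub (hm b)) (((hm c).sub (hm d)).const_smul _) hp1').trans ?_
  rw [eLpNorm_const_smul, ← ofReal_norm, Complex.norm_I, ENNReal.ofReal_one, one_mul]
  refine (add_le_add ((eLpNorm_sub_le (hm a) (hm b) hp1').trans (add_le_add (hH _ n1) (hH _ n2)))
    ((eLpNorm_sub_le (hm c) (hm d) hp1').trans (add_le_add (hH _ n3) (hH _ n4)))).trans_eq ?_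
  push_cast
  ring

theorem isHilbertBounded_two : IsHilbertBounded 2 := by
  refine ⟨1, fun φ _ => le_of_eq ?_⟩
  have := norm_hilbertL2 φ
  rw [Lp.norm_def, Lp.norm_def, ENNReal.toReal_eq_toReal_iff' (Lp.eLpNorm_ne_top _)
    (Lp.eLpNorm_ne_top _)] at this
  rw [this, ENNReal.coe_one, one_mul]

open scoped ComplexInnerProductSpace in
/-- The bound for an exponent `p > 2` follows by duality from the bound for the conjugate
exponent. -/
theorem isHilbertBounded_of_two_lt {p : ℝ} (hp : 2 < p) :
    IsHilbertBounded (ENNReal.ofReal p) := by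
  have hp1 : 1 < p := by linarith
  have hp0 : 0 < p := by linarith
  have hpq := Real.HolderConjugate.conjExponent hp1
  set q := p.conjExponent with hq
  have hq0 : 0 < q := hpq.symm.pos
  have hq1 : 1 < q := hpq.symm.lt
  have hq2 : q < 2 := by
    rw [hq, Real.conjExponent, div_lt_iff₀ (by linarith)]
    linarith
  obtain ⟨C, hC⟩ := isHilbertBounded_of_lt_two hq1 hq2
  refine ⟨C, fun φ _ => ?_⟩
  set h := hilbertL2 φ
  have hm : Measurable (h : ℝ → ℂ) := (Lp.stronglyMeasurable h).measurable
  set N := eLpNorm φ (ENNReal.ofReal p) volume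
  -- Where |h| ≤ n, |h|ᵖ is at most n^(p-2)|h|², so h being in L² makes the integrals J below finite
  -- and puts the test functions g in L².
  let S : ℕ → Set ℝ := fun n => {x | ‖(h : ℝ → ℂ) x‖ ≤ n}
  have hS : ∀ n, MeasurableSet (S n) := fun n => measurableSet_le hm.norm measurable_const
  have hcover : AECover (volume : Measure ℝ) atTop S := by
    refine ⟨Eventually.of_forall fun x => ?_, hS⟩
    obtain ⟨n, hn⟩ := exists_nat_ge ‖(h : ℝ → ℂ) x‖
    filter_upwards [eventually_ge_atTop n] with m hnm
    exact hn.trans (by exact_mod_cast hnm)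
  have hbound : ∀ n, ∫⁻ x in S n, ‖(h : ℝ → ℂ) x‖ₑ ^ p ≤ (C * N) ^ p := by
    intro n
    set J := ∫⁻ x in S n, ‖(h : ℝ → ℂ) x‖ₑ ^ p with hJ
    -- The extremal function of Hölder's inequality: |g|^q = |h|ᵖ on `S n`, and its inner product
    -- with h is J.
    let g : ℝ → ℂ := (S n).indicator fun x =>
      ((‖(h : ℝ → ℂ) x‖ ^ (p - 2) : ℝ) : ℂ) * (h : ℝ → ℂ) x
    have hgm : Measurable g :=
      ((Complex.measurable_ofReal.comp (hm.norm.pow_const _)).mul hm).indicator (hS n)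
    have hg2 : MemLp g 2 volume := by
      refine ((Lp.memLp h).const_mul (((n : ℝ) ^ (p - 2) : ℝ) : ℂ)).of_le
        hgm.aestronglyMeasurable (Eventually.of_forall fun x => ?_)
      by_cases hx : x ∈ S n
      · simp only [g, Set.indicator_of_mem hx]
        rw [norm_mul, norm_mul, Complex.norm_real, Complex.norm_real,
          Real.norm_of_nonneg (by positivity), Real.norm_of_nonneg (by positivity)]
        gcongr
        exact hx
      · simp only [g, Set.indicator_of_notMem hx, norm_zero]
        positivity
    have hgn : ∀ x ∈ S n, ‖g x‖ = ‖(h : ℝ → ℂ) x‖ ^ (p - 1) := fun x hx => by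
      simp only [g, Set.indicator_of_mem hx]
      rw [norm_mul, Complex.norm_real, Real.norm_of_nonneg (by positivity),
        show p - 1 = p - 2 + 1 by ring, Real.rpow_add_one' (norm_nonneg _) (by linarith)]
    have hgq : ∫⁻ x, ‖g x‖ₑ ^ q = J := by
      rw [hJ, ← lintegral_indicator (hS n)]
      refine lintegral_congr fun x => ?_
      by_cases hx : x ∈ S n
      · rw [Set.indicator_of_mem hx, ← ofReal_norm, hgn x hx, ← ofReal_norm,
          ENNReal.ofReal_rpow_of_nonneg (by positivity) hq0.le,
          ENNReal.ofReal_rpow_of_nonneg (norm_nonneg _) hp0.le, ← Real.rpow_mul (norm_nonneg _),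
          hpq.sub_one_mul_conj]
      · rw [Set.indicator_of_notMem hx]
        simp [g, Set.indicator_of_notMem hx, hq0]
    have hJfin : J ≠ ∞ := by
      have h2fin : ∫⁻ x, ‖(h : ℝ → ℂ) x‖ₑ ^ (2 : ℝ) ≠ ∞ := by
        have := lintegral_rpow_enorm_lt_top_of_eLpNorm_lt_top (by norm_num) (by norm_num)
          (Lp.memLp h).2
        simpa using this.ne
      refine ((lt_of_le_of_lt ?_ (ENNReal.mul_lt_top
        (ENNReal.ofReal_lt_top (r := (n : ℝ) ^ (p - 2))) h2fin.lt_top)).ne)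
      rw [← lintegral_const_mul _ (by fun_prop), hJ, ← lintegral_indicator (hS n)]
      refine lintegral_mono fun x => ?_
      by_cases hx : x ∈ S n
      · rw [Set.indicator_of_mem hx, ← ofReal_norm,
          ENNReal.ofReal_rpow_of_nonneg (norm_nonneg _) hp0.le,
          ENNReal.ofReal_rpow_of_nonneg (norm_nonneg _) (by norm_num),
          ← ENNReal.ofReal_mul (by positivity)]
        refine ENNReal.ofReal_le_ofReal ?_
        calc ‖(h : ℝ → ℂ) x‖ ^ p = ‖(h : ℝ → ℂ) x‖ ^ (p - 2) * ‖(h : ℝ → ℂ) x‖ ^ (2 : ℝ) := by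
              rw [← Real.rpow_add' (norm_nonneg _) (by linarith)]
              congr 1; ring
          _ ≤ _ := by
              gcongr
              exact hx
      · rw [Set.indicator_of_notMem hx]
        exact zero_le
    have hgqn : eLpNorm g (ENNReal.ofReal q) volume = J ^ (1 / q) := by
      rw [eLpNorm_eq_lintegral_rpow_enorm_toReal (by simpa using hq0) ENNReal.ofReal_ne_top,
        ENNReal.toReal_ofReal hq0.le, hgq]
    set γ := hg2.toLp g
    have hγq : eLpNorm γ (ENNReal.ofReal q) volume = J ^ (1 / q) := by
      rw [eLpNorm_congr_ae hg2.coeFn_toLp, hgqn]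
    have hγmem : MemLp γ (ENNReal.ofReal q) volume :=
      ⟨Lp.aestronglyMeasurable _, hγq ▸ ENNReal.rpow_lt_top_of_nonneg (by positivity) hJfin⟩
    have hJinner : J = ‖⟪γ, h⟫‖ₑ := by
      have hpt : ∀ x, ‖(S n).indicator (fun x => ‖(h : ℝ → ℂ) x‖ ^ p) x‖ₑ =
          (S n).indicator (fun x => ‖(h : ℝ → ℂ) x‖ₑ ^ p) x := fun x => by
        by_cases hx : x ∈ S n
        · rw [Set.indicator_of_mem hx, Set.indicator_of_mem hx,
            Real.enorm_of_nonneg (by positivity), ← ofReal_norm,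
            ENNReal.ofReal_rpow_of_nonneg (norm_nonneg _) hp0.le]
        · rw [Set.indicator_of_notMem hx, Set.indicator_of_notMem hx, enorm_zero]
      have h0 : ∀ x, 0 ≤ (S n).indicator (fun x => ‖(h : ℝ → ℂ) x‖ ^ p) x :=
        Set.indicator_nonneg fun x _ => by positivity
      have hJ' : J = ∫⁻ x, ‖(S n).indicator (fun x => ‖(h : ℝ → ℂ) x‖ ^ p) x‖ₑ := by
        simp_rw [hpt]
        rw [lintegral_indicator (hS n)]
      have hint : Integrable ((S n).indicator (fun x => ‖(h : ℝ → ℂ) x‖ ^ p)) :=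
        ⟨((hm.norm.pow_const p).indicator (hS n)).aestronglyMeasurable,
          by rw [HasFiniteIntegral, ← hJ']; exact hJfin.lt_top⟩
      have hin : ⟪γ, h⟫ = ((∫ x, (S n).indicator (fun x => ‖(h : ℝ → ℂ) x‖ ^ p) x : ℝ) : ℂ) := by
        rw [L2.inner_def, ← integral_complex_ofReal]
        refine integral_congr_ae ?_
        filter_upwards [hg2.coeFn_toLp] with x hx
        rw [hx, RCLike.inner_apply]
        by_cases hxS : x ∈ S n
        · simp only [g, Set.indicator_of_mem hxS, map_mul, Complex.conj_ofReal]
          rw [mul_left_comm, Complex.mul_conj, Complex.normSq_eq_norm_sq, ← Complex.ofReal_mul,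
            ← Real.rpow_natCast, ← Real.rpow_add' (norm_nonneg _) (by push_cast; linarith)]
          congr 2
          push_cast; ring
        · simp [g, Set.indicator_of_notMem hxS]
      rw [hin, ← ofReal_norm, Complex.norm_real, ofReal_norm, Real.enorm_of_nonneg (integral_nonneg h0),
        ofReal_integral_eq_lintegral_ofReal hint (Eventually.of_forall h0), hJ']
      exact lintegral_congr fun x => Real.enorm_of_nonneg (h0 x)
    -- Skew-adjointness moves H from φ to γ, where the bound for q < 2 applies. Dividing by J^(1/q),
    -- which is legitimate when 0 < J < ∞, then leaves J^(1/p) ≤ C N.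
    have hle : J ≤ C * N * J ^ (1 / q) := by
      calc J = ‖⟪hilbertL2 γ, φ⟫‖ₑ := by
            rw [hJinner, inner_hilbertL2 γ φ, enorm_neg]
        _ ≤ ∫⁻ x, ‖(hilbertL2 γ : ℝ → ℂ) x‖ₑ * ‖(φ : ℝ → ℂ) x‖ₑ := by
            rw [L2.inner_def]
            refine (enorm_integral_le_lintegral_enorm _).trans_eq (lintegral_congr fun x => ?_)
            rw [RCLike.inner_apply, enorm_mul, RCLike.enorm_conj, mul_comm]
        _ ≤ eLpNorm (hilbertL2 γ) (ENNReal.ofReal q) volume * N := by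
            have := ENNReal.lintegral_mul_le_Lp_mul_Lq volume hpq.symm
              (Lp.aestronglyMeasurable (hilbertL2 γ)).enorm (Lp.aestronglyMeasurable φ).enorm
            simpa only [N, Pi.mul_apply,
              eLpNorm_eq_lintegral_rpow_enorm_toReal (ENNReal.ofReal_pos.2 hq0).ne'
                ENNReal.ofReal_ne_top,
              eLpNorm_eq_lintegral_rpow_enorm_toReal (ENNReal.ofReal_pos.2 hp0).ne'
                ENNReal.ofReal_ne_top, ENNReal.toReal_ofReal hq0.le,
              ENNReal.toReal_ofReal hp0.le] using this
        _ ≤ C * J ^ (1 / q) * N := by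
            gcongr
            exact hγq ▸ hC γ hγmem
        _ = _ := by ring
    rcases eq_or_ne J 0 with hJ0 | hJ0
    · rw [hJ0]; exact zero_le
    have hsplit : J = J ^ (1 / p) * J ^ (1 / q) := by
      rw [← ENNReal.rpow_add _ _ hJ0 hJfin, one_div, one_div, hpq.inv_add_inv_eq_one,
        ENNReal.rpow_one]
    have hcancel : J ^ (1 / p) ≤ C * N := by
      refine (ENNReal.mul_le_mul_iff_left (c := J ^ (1 / q)) ?_ ?_).1 (hsplit ▸ hle)
      · exact (ENNReal.rpow_pos (pos_iff_ne_zero.2 hJ0) hJfin).ne'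
      · exact ENNReal.rpow_ne_top_of_nonneg (by positivity) hJfin
    calc J = (J ^ (1 / p)) ^ p := by
          rw [← ENNReal.rpow_mul, one_div, inv_mul_cancel₀ hp0.ne', ENNReal.rpow_one]
      _ ≤ _ := by gcongr
  have hlim := hcover.lintegral_tendsto_of_countably_generated
    (f := fun x => ‖(h : ℝ → ℂ) x‖ₑ ^ p) (by fun_prop)
  have hfinal := le_of_tendsto' hlim hbound
  rw [eLpNorm_eq_lintegral_rpow_enorm_toReal (by simpa using hp0) ENNReal.ofReal_ne_top,
    ENNReal.toReal_ofReal hp0.le]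
  calc _ ≤ ((C * N) ^ p) ^ (1 / p) := by gcongr
    _ = _ := by rw [← ENNReal.rpow_mul, one_div, mul_inv_cancel₀ hp0.ne', ENNReal.rpow_one]

/-- M. Riesz: the Hilbert transform is bounded on `Lᵖ(ℝ)` for `1 < p < ∞`. -/
theorem isHilbertBounded {p : ℝ≥0∞} (hp1 : 1 < p) (hp : p < ∞) : IsHilbertBounded p := by
  lift p to NNReal using hp.ne
  have h1 : (1 : ℝ) < p := by exact_mod_cast hp1
  rw [← ENNReal.ofReal_coe_nnreal]
  rcases lt_trichotomy (p : ℝ) 2 with h | h | h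
  · exact isHilbertBounded_of_lt_two h1 h
  · rw [h, ENNReal.ofReal_ofNat]
    exact isHilbertBounded_two
  · exact isHilbertBounded_of_two_lt h

end

end

/-! ### The proposition -/

theorem mainTheorem3 (p : ℝ≥0∞) [Fact (1 ≤ p)] (hp1 : 1 < p) (hp : p < ∞) :
    -- the Hilbert transform exists as a bounded operator on `Lᵖ(ℝ)`, and is unique
    ExtendsHilbertL2 p (hilbertTransform p) ∧
    (∀ T : Lp ℂ p (volume : Measure ℝ) →L[ℂ] Lp ℂ p (volume : Measure ℝ),
      ExtendsHilbertL2 p T → T = hilbertTransform p) ∧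
    -- `H² = -I`
    hilbertTransform p ∘L hilbertTransform p =
      -ContinuousLinearMap.id ℂ (Lp ℂ p (volume : Measure ℝ)) ∧
    -- composition law, neutral element, inverses
    (∀ τ₁ τ₂ : ℝ, fHT p τ₁ ∘L fHT p τ₂ = fHT p (τ₁ + τ₂)) ∧
    fHT p 0 = ContinuousLinearMap.id ℂ (Lp ℂ p (volume : Measure ℝ)) ∧
    (∀ τ : ℝ, fHT p τ ∘L fHT p (-τ) = ContinuousLinearMap.id ℂ (Lp ℂ p (volume : Measure ℝ)) ∧
      fHT p (-τ) ∘L fHT p τ = ContinuousLinearMap.id ℂ (Lp ℂ p (volume : Measure ℝ))) ∧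
    -- the operators `H_τ` are exactly the elements of a commutative group of automorphisms
    -- of `Lᵖ(ℝ)` under composition
    ∃ G : Subgroup (Lp ℂ p (volume : Measure ℝ) ≃L[ℂ] Lp ℂ p (volume : Measure ℝ)),
      (∀ A ∈ G, ∀ B ∈ G, A * B = B * A) ∧
      (fun A : Lp ℂ p (volume : Measure ℝ) ≃L[ℂ] Lp ℂ p (volume : Measure ℝ) =>
        (A : Lp ℂ p (volume : Measure ℝ) →L[ℂ] Lp ℂ p (volume : Measure ℝ))) '' (G : Set _) =
        Set.range (fHT p) := by
  have hb := isHilbertBounded hp1 hp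
  have hH := extendsHilbertL2_hilbertTransform hp.ne hb
  have hsq := hH.comp_self hp.ne hb
  have hcomp := fHT_comp_fHT hsq
  refine ⟨hH, fun T hT => hT.eq hp.ne hb hH, hsq, hcomp, fHT_zero p, fun τ => ⟨?_, ?_⟩,
    (fHTHom hsq).range, ?_, ?_⟩
  · rw [hcomp, add_neg_cancel, fHT_zero]
  · rw [hcomp, neg_add_cancel, fHT_zero]
  · rintro _ ⟨a, rfl⟩ _ ⟨b, rfl⟩
    rw [← map_mul, ← map_mul, mul_comm]
  · ext T
    constructor
    · rintro ⟨_, ⟨a, rfl⟩, rfl⟩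
      exact ⟨a.toAdd, rfl⟩
    · rintro ⟨a, rfl⟩
      exact ⟨_, ⟨Multiplicative.ofAdd a, rfl⟩, rfl⟩
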